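/- **Setting.** Let $\Pi$ be a finite non-empty set of policies, $\mathcal O$ a measurable space of observations, and $\mathcal M$ a finite class of models. A model $M$ assigns to each $\pi\in\Pi$ a probability measure $M(\cdot|\pi)$ on $\mathcal O$, and has a value function $V_M:\Pi\to[0,1]$. Mixtures of models average both the observation laws and the value functions; $\mathrm{co}(\mathcal S)$ is the set of all finite mixtures of models in $\mathcal S$, and $\pi_M\in\arg\max_\pi V_M(\pi)$. Let $\Phi$ be a family of pairwise disjoint subsets ("cells") of $\mathcal M\times\Pi$, let $\Psi=\bigcup_{\phi\in\Phi}\phi$, and for a distribution $\nu$ on $\mathcal M\times\Pi$ let $M^\nu$ be the mixture $\mathbb E_{(M,\pi^\star)\sim\nu}[M]$. For $\eta>0$, $\rho\in\Delta(\Phi)$, $p\in\Delta(\Pi)$, $\nu\in\Delta(\Psi)$ put $$\mathsf{AIR}^{\Phi}_{\rho,\eta}(p,\nu)=\mathbb E_{\pi\sim p}\,\mathbb E_{(M,\pi^\star)\sim\nu}\,\mathbb E_{o\sim M(\cdot|\pi)}\Big[V_M(\pi^\star)-V_M(\pi)-\tfrac1\eta\mathrm{KL}\big(\nu_\phi(\cdot|\pi,o),\rho\big)\Big],$$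 where $\nu_\phi(\cdot|\pi,o)$ is the posterior distribution of the cell containing $(M,\pi^\star)$, given $(\pi,o)$. Further put $$\mathsf{DEC}_\eta(\mathcal S)=\sup_{\bar M\in\mathrm{co}(\mathcal S)}\ \inf_{p\in\Delta(\Pi)}\ \sup_{M\in\mathcal S}\ \mathbb E_{\pi\sim p}\Big[V_M(\pi_M)-V_M(\pi)-\tfrac1\eta \mathrm{KL}\big(M(\cdot|\pi),\bar M(\cdot|\pi)\big)\Big]$$ for a class of models $\mathcal S$, $$\mathsf{DEC}_\eta(\mathcal M,\Phi)=\sup_{\bar M\in\mathrm{co}(\mathcal M)}\ \inf_{p\in\Delta(\Pi)}\ \sup_{\phi\in\Phi}\ \sup_{\nu\in\Delta(\phi)}\ \mathbb E_{\pi\sim p}\Big[\mathbb E_{(M,\pi^\star)\sim\nu}[V_M(\pi^\star)]-V_{M^\nu}(\pi)-\tfrac1\eta \mathrm{KL}\big(M^\nu(\cdot|\pi),\bar M(\cdot|\pi)\big)\Big],$$ $$\bar{\mathcal M}(\Phi)=\bigcup_{\phi\in\Phi}\mathrm{co}\big(\{M:\exists\pi,\ (M,\pi)\in\phi\}\big),\qquad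 C(\Phi)=\sup_{\phi\in\Phi}\ \sup_{\nu\in\Delta(\phi)}\Big(\mathbb E_{(M,\pi^\star)\sim\nu}[V_M(\pi^\star)]-V_{M^\nu}(\pi_{M^\nu})\Big)$$ (with $C(\Phi)=0$ if $\Psi=\emptyset$). All values lie in $[-\infty,\infty]$, with $0\cdot\infty=0$. A $\Phi$-restricted environment commits to a cell $\phi^\star\in\Phi$ and in each round $t$ selects, possibly at random and depending on the history, a pair $(M_t,\pi_t^\star)\in\phi^\star$; the learner, knowing only the past policies and observations, selects $\pi_t$ (possibly at random) and observes $o_t\sim M_t(\cdot|\pi_t)$. **Statement.** 1. For all $\eta>0$: $\ \sup_{\rho\in\Delta(\Phi)}\sup_{\nu\in\Delta(\Psi)}\inf_{p\in\Delta(\Pi)}\mathsf{AIR}^\Phi_{\rho,\eta}(p,\nu)=\mathsf{DEC}_\eta(\mathcal M,\Phi)$. 2. If $C(\Phi)\le 0$, then for all $\eta>0$: $\ \sup_{\rho\in\Delta(\Phi)}\sup_{\nu\in\Delta(\Psi)}\inf_{p\in\Delta(\Pi)}\mathsf{AIR}^\Phi_{\rho,\eta}(p,\nu)\le\mathsf{DEC}_\eta(\bar{\mathcal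 M}(\Phi))$. 3. If $C(\Phi)>0$, then some cell of $\Phi$ contains two different comparator policies (so $C(\Phi)\le0$ whenever every cell has a single comparator policy); for all $\eta>0$, $\ \sup_{\rho\in\Delta(\Phi)}\sup_{\nu\in\Delta(\Psi)}\inf_{p\in\Delta(\Pi)}\mathsf{AIR}^\Phi_{\rho,\eta}(p,\nu)\ge C(\Phi)$, a positive bound that is independent of $\eta$; and sublinear regret is impossible: there is a $\Phi$-restricted environment against which every learner satisfies $\mathbb E\big[\sum_{t=1}^T (V_{M_t}(\pi_t^\star)-V_{M_t}(\pi_t))\big]\ge C(\Phi)\,T$ for every $T$. -/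

import Mathlib

open MeasureTheory ProbabilityTheory InformationTheory
open scoped ENNReal

namespace DecisionMaking

/-- A model: for every policy a distribution over observations, together with its value function
`V_M`, which takes values in `[0, 1]`. -/
structure Model (Pol O : Type*) [MeasurableSpace O] where
  law : Pol → Measure O
  isProb : ∀ π, IsProbabilityMeasure (law π)
  value : Pol → ℝ
  value_mem : ∀ π, value π ∈ Set.Icc (0 : ℝ) 1

/-- The mixture `M^w` of the models `m k` with weights `w k`: `M^w(· | π) = ∑ k, w k • m k (· | π)`
and `V_{M^w}(π) = ∑ k, w k * V_{m k}(π)`. -/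
noncomputable def mixture {Pol O κ : Type*} [MeasurableSpace O] [Fintype κ]
    (w : κ → ℝ) (hw : w ∈ stdSimplex ℝ κ) (m : κ → Model Pol O) : Model Pol O where
  law π := ∑ k, ENNReal.ofReal (w k) • (m k).law π
  isProb π := by
    constructor
    have h : ∀ k, (m k).law π Set.univ = 1 := fun k => (m k).isProb π |>.measure_univ
    simp only [Measure.coe_finsetSum, Finset.sum_apply, Measure.smul_apply, h, smul_eq_mul,
      mul_one]
    rw [← ENNReal.ofReal_sum_of_nonneg (fun k _ => hw.1 k), hw.2, ENNReal.ofReal_one]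
  value π := ∑ k, w k * (m k).value π
  value_mem π := by
    refine ⟨Finset.sum_nonneg fun k _ => mul_nonneg (hw.1 k) ((m k).value_mem π).1, ?_⟩
    calc ∑ k, w k * (m k).value π ≤ ∑ k, w k :=
          Finset.sum_le_sum fun k _ => mul_le_of_le_one_right (hw.1 k) ((m k).value_mem π).2
      _ = 1 := hw.2

/-- The convex hull of a class of models: all finite mixtures of its members. -/
def co {Pol O : Type*} [MeasurableSpace O] (S : Set (Model Pol O)) : Set (Model Pol O) :=
  {M | ∃ (n : ℕ) (w : Fin n → ℝ) (hw : w ∈ stdSimplex ℝ (Fin n)) (m : Fin n → Model Pol O),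
    (∀ k, m k ∈ S) ∧ M = mixture w hw m}

/-- A policy `π_M` that maximizes `V_M`. -/
noncomputable def Model.opt {Pol O : Type*} [MeasurableSpace O] [Finite Pol] [Nonempty Pol]
    (M : Model Pol O) : Pol :=
  (Finite.exists_max M.value).choose

/-- `Δ(S)` for a finite subset `S` of a finite type. -/
def distOn {κ : Type*} [Fintype κ] (S : Finset κ) : Set (κ → ℝ) :=
  {ν | ν ∈ stdSimplex ℝ κ ∧ ∀ x, x ∉ S → ν x = 0}

/-- `E_{π ∼ p} [g π - (1/η) * D π]` for a real-valued gain `g` and a divergence `D` that may be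
infinite; it is `-∞` exactly if `D` is infinite with positive probability. -/
noncomputable def offset {Pol : Type*} [Fintype Pol]
    (η : ℝ) (p : Pol → ℝ) (g : Pol → ℝ) (D : Pol → ℝ≥0∞) : EReal :=
  ((∑ π, p π * g π : ℝ) : EReal)
    - ((ENNReal.ofReal (1 / η) * ∑ π, ENNReal.ofReal (p π) * D π : ℝ≥0∞) : EReal)

/-- The offset decision-estimation coefficient with KL divergence of a class of models. -/
noncomputable def DEC {Pol O : Type*} [MeasurableSpace O] [Fintype Pol] [Nonempty Pol]
    (η : ℝ) (S : Set (Model Pol O)) : EReal :=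
  ⨆ N ∈ co S, ⨅ p ∈ stdSimplex ℝ Pol, ⨆ M ∈ S,
    offset η p (fun π => M.value M.opt - M.value π) (fun π => klDiv (M.law π) (N.law π))

section Phi

variable {ι Pol O : Type*} [Fintype ι] [Fintype Pol] [MeasurableSpace O]

/-- The models that occur in a set of pairs (model, comparator policy). -/
def cellModels (m : ι → Model Pol O) (φ : Finset (ι × Pol)) : Set (Model Pol O) :=
  {M | ∃ i π, (i, π) ∈ φ ∧ m i = M}

/-- The `Φ`-aware convexification of the model class. -/
def convexification (m : ι → Model Pol O) (Φ : Finset (Finset (ι × Pol))) :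
    Set (Model Pol O) :=
  ⋃ φ ∈ Φ, co (cellModels m φ)

/-- The mixture `M^ν` of the models under a distribution `ν` of pairs (model, comparator). -/
noncomputable def mix (m : ι → Model Pol O) (ν : ι × Pol → ℝ)
    (hν : ν ∈ stdSimplex ℝ (ι × Pol)) : Model Pol O :=
  mixture ν hν (fun ψ => m ψ.1)

/-- `E_{(M, π⋆) ∼ ν} [V_M(π⋆)]`. -/
def comparatorValue (m : ι → Model Pol O) (ν : ι × Pol → ℝ) : ℝ :=
  ∑ ψ, ν ψ * (m ψ.1).value ψ.2

/-- The `Φ`-dependent decision-estimation coefficient. -/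
noncomputable def DECPhi (η : ℝ) (m : ι → Model Pol O) (Φ : Finset (Finset (ι × Pol))) : EReal :=
  ⨆ N ∈ co (Set.range m), ⨅ p ∈ stdSimplex ℝ Pol, ⨆ φ ∈ Φ, ⨆ (ν) (hν : ν ∈ distOn φ),
    offset η p (fun π => comparatorValue m ν - (mix m ν hν.1).value π)
      (fun π => klDiv ((mix m ν hν.1).law π) (N.law π))

/-- The density `M(o | π)` of the observation, with respect to the sum over all models of their
observation laws under `π` (a measure that dominates all of them). -/
noncomputable def density (m : ι → Model Pol O) (i : ι) (π : Pol) (o : O) : ℝ :=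
  (((m i).law π).rnDeriv (∑ j, (m j).law π) o).toReal

/-- The posterior probability `ν(φ | π, o)` of the cell `φ` of `Φ`. -/
noncomputable def posterior (m : ι → Model Pol O) (Φ : Finset (Finset (ι × Pol)))
    (ν : ι × Pol → ℝ) (π : Pol) (o : O) (φ : Φ) : ℝ :=
  (∑ ψ ∈ φ.1, ν ψ * density m ψ.1 π o) / ∑ φ' ∈ Φ, ∑ ψ ∈ φ', ν ψ * density m ψ.1 π o

open Classical in
/-- The KL divergence of two distributions on a finite set. -/
noncomputable def finKL {κ : Type*} [Fintype κ] (a b : κ → ℝ) : ℝ≥0∞ :=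
  if ∃ k, b k = 0 ∧ a k ≠ 0 then ∞ else ENNReal.ofReal (∑ k, a k * Real.log (a k / b k))

/-- `AIR^Φ_{ρ,η}(p, ν)`. -/
noncomputable def AIR (η : ℝ) (m : ι → Model Pol O) (Φ : Finset (Finset (ι × Pol)))
    (ρ : Φ → ℝ) (p : Pol → ℝ) (ν : ι × Pol → ℝ) : EReal :=
  offset η p (fun π => ∑ ψ, ν ψ * ((m ψ.1).value ψ.2 - (m ψ.1).value π))
    (fun π => ∑ ψ, ENNReal.ofReal (ν ψ) *
      ∫⁻ o, finKL (posterior m Φ ν π o) ρ ∂((m ψ.1).law π))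

/-- The value `max_ρ max_ν min_p AIR^Φ_{ρ,η}(p, ν)` with `ρ ∈ Δ(Φ)`, `ν ∈ Δ(Ψ)`, where `Ψ` is the
union of the cells of `Φ`, and `p ∈ Δ(Π)`. -/
noncomputable def AIRValue [DecidableEq ι] [DecidableEq Pol]
    (η : ℝ) (m : ι → Model Pol O) (Φ : Finset (Finset (ι × Pol))) : EReal :=
  ⨆ ρ ∈ stdSimplex ℝ Φ, ⨆ ν ∈ distOn (Φ.biUnion id), ⨅ p ∈ stdSimplex ℝ Pol, AIR η m Φ ρ p ν

/-- `C(Φ)`: the largest advantage, over distributions `ν` on a cell, of the comparator drawn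
jointly with the model over the best policy for the mixture model `M^ν`. -/
noncomputable def comparatorGap [Nonempty Pol] (m : ι → Model Pol O)
    (Φ : Finset (Finset (ι × Pol))) : ℝ :=
  sSup {x | ∃ φ ∈ Φ, ∃ (ν : ι × Pol → ℝ) (hν : ν ∈ distOn φ),
    x = comparatorValue m ν - (mix m ν hν.1).value (mix m ν hν.1).opt}

/-- All comparators in a cell of `Φ` agree. -/
def FixedComparator (Φ : Finset (Finset (ι × Pol))) : Prop :=
  ∀ φ ∈ Φ, ∀ ψ ∈ φ, ∀ ψ' ∈ φ, ψ.2 = ψ'.2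

end Phi

section Game

/-- What happens in one round: the environment's pair (model, comparator), the learner's policy
and the observation. -/
abbrev Round (ι Pol O : Type*) := ((ι × Pol) × Pol) × O

/-- A (randomized) learner: a distribution over policies given the past policies and
observations. -/
structure Learner (Pol O : Type*) [MeasurableSpace Pol] [MeasurableSpace O] where
  act : (t : ℕ) → Kernel (Fin t → Pol × O) Pol
  markov : ∀ t, IsMarkovKernel (act t)

/-- A (randomized) `Φ`-restricted environment: it commits to a cell of `Φ` and selects in every
round a pair (model, comparator) in this cell, based on the whole history. -/
structure Environment {ι Pol : Type*} (O : Type*) [MeasurableSpace ι] [MeasurableSpace Pol]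
    [MeasurableSpace O] (Φ : Finset (Finset (ι × Pol))) where
  cell : Finset (ι × Pol)
  cell_mem : cell ∈ Φ
  select : (t : ℕ) → Kernel (Fin t → Round ι Pol O) (ι × Pol)
  markov : ∀ t, IsMarkovKernel (select t)
  select_mem : ∀ t h, ∀ᵐ ψ ∂(select t h), ψ ∈ cell

variable {ι Pol O : Type*} [Fintype ι] [Fintype Pol]
  [MeasurableSpace ι] [MeasurableSingletonClass ι] [MeasurableSpace Pol]
  [MeasurableSingletonClass Pol] [MeasurableSpace O]

/-- The law of the observation given the round's pair (model, comparator) and policy. -/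
noncomputable def obsKernel (m : ι → Model Pol O) : Kernel ((ι × Pol) × Pol) O :=
  ⟨fun x => (m x.1.1).law x.2, measurable_of_countable _⟩

/-- The law of the next round given the history: environment and learner choose independently
given the history, and then the observation is drawn. -/
noncomputable def stepKernel (m : ι → Model Pol O) {Φ : Finset (Finset (ι × Pol))}
    (E : Environment O Φ) (L : Learner Pol O) (t : ℕ) :
    Kernel (Fin t → Round ι Pol O) (Round ι Pol O) :=
  (E.select t ×ₖ (L.act t).comap (fun h s => ((h s).1.2, (h s).2)) (by fun_prop))
    ⊗ₖ (obsKernel m).prodMkLeft _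

/-- The law of the first `t` rounds. -/
noncomputable def historyLaw (m : ι → Model Pol O) {Φ : Finset (Finset (ι × Pol))}
    (E : Environment O Φ) (L : Learner Pol O) : (t : ℕ) → Measure (Fin t → Round ι Pol O)
  | 0 => Measure.dirac (fun s => s.elim0)
  | t + 1 => (historyLaw m E L t ⊗ₘ stepKernel m E L t).map
      (fun x => (Fin.snoc x.1 x.2 : Fin (t + 1) → Round ι Pol O))

/-- The expected regret after `T` rounds against the comparators chosen by the environment. -/
noncomputable def expectedRegret (m : ι → Model Pol O) {Φ : Finset (Finset (ι × Pol))}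
    (E : Environment O Φ) (L : Learner Pol O) (T : ℕ) : ℝ :=
  ∫ h, ∑ t, ((m (h t).1.1.1).value (h t).1.1.2 - (m (h t).1.1.1).value (h t).1.2)
    ∂(historyLaw m E L T)

end Game

end DecisionMaking

/-! Everything rests on rewriting the information term with densities. With respect to the sum of
all observation laws, the expected divergence of the posterior over cells from `ρ` is the sum over
cells of the integral of `relEnt` between the density of `ν` on the cell and `ρ φ` times the density
of `M^ν`. The correction `y - x` in `entTerm` makes the integrand nonnegative, so no integrability
conditions arise, and `relEnt` is homogeneous and subadditive, hence jointly convex.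

Upper bounds: take `M^ν` as reference model, which does not depend on `p`. Replacing `ρ` by the cell
masses of `ν` only lowers the divergence (`lintegral_relEnt_mul_le`). The result is the average over
cells of the divergence of the conditional mixture from `M^ν`. Hence AIR is at most an average of
the cell objectives, and some cell attains at least this average (`exists_cell_AIR_le_offset`). If
`C(Φ) ≤ 0`, the comparator value of that cell is at most the optimal value of its mixture, which
gives the bound by the DEC of the convexified class.

Lower bound of the equality: fix a reference model `N`. The vectors of payoffs, indexed by policies,
that distributions `ν` guarantee against `N` form a convex set. Taking the cell masses of `ν` as
prior, and `M^ν` as the best reference (`sum_relEnt_mul_sum_le`), no such vector exceeds `c` in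
every coordinate when the AIR value is below `c`. Separating this set from an open orthant gives a
distribution over policies that is good against all `ν` at once. A little uniform exploration deals
with infinite divergences.

Positive gap: by compactness some `ν` on one cell attains `C(Φ)`, so every policy has expected
regret at least `C(Φ)` under `ν`. A prior concentrated on that cell makes the information term
vanish, and independent draws from `ν` force this regret in every round. -/

namespace DecisionMaking

/-! ### Pointwise and integrated relative entropy -/

section RelEnt

/-- The integrand `x log (x / y) + y - x` of the relative entropy for densities `x` and `y`. -/
noncomputable def entTerm (x y : ℝ) : ℝ := x * Real.log (x / y) + y - x

/-- `entTerm`, with the value `∞` for `x ≠ 0` and `y = 0`. -/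
noncomputable def relEnt (x y : ℝ) : ℝ≥0∞ :=
  open Classical in if y = 0 ∧ x ≠ 0 then ∞ else ENNReal.ofReal (entTerm x y)

lemma relEnt_zero_right {x : ℝ} (hx : x ≠ 0) : relEnt x 0 = ∞ := by
  simp [relEnt, hx]

lemma relEnt_of_imp {x y : ℝ} (h : y = 0 → x = 0) :
    relEnt x y = ENNReal.ofReal (entTerm x y) := by
  rw [relEnt, if_neg]
  rintro ⟨h1, h2⟩
  exact h2 (h h1)

lemma imp_of_relEnt_ne_top {x y : ℝ} (h : relEnt x y ≠ ∞) : y = 0 → x = 0 := by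
  rintro rfl
  by_contra hx
  exact h (relEnt_zero_right hx)

@[simp]
lemma relEnt_zero_zero : relEnt 0 0 = 0 := by
  simp [relEnt, entTerm]

lemma entTerm_eq_mul_klFun {x y : ℝ} (h : y = 0 → x = 0) :
    entTerm x y = y * klFun (x / y) := by
  by_cases hy : y = 0
  · simp [hy, h hy, entTerm]
  · rw [entTerm, klFun_apply]
    field_simp

lemma entTerm_nonneg {x y : ℝ} (hx : 0 ≤ x) (hy : 0 ≤ y) (h : y = 0 → x = 0) :
    0 ≤ entTerm x y := by
  rw [entTerm_eq_mul_klFun h]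
  exact mul_nonneg hy (klFun_nonneg (div_nonneg hx hy))

/-- The tangent of `entTerm` at the ratio `s` is a lower bound. -/
lemma tangent_le_entTerm {x y s : ℝ} (hx : 0 ≤ x) (hy : 0 ≤ y) (h : y = 0 → x = 0) (hs : 0 < s) :
    x * Real.log s + y * (1 - s) ≤ entTerm x y := by
  rcases hx.eq_or_lt with rfl | hx'
  · simp only [entTerm, zero_mul, zero_add, sub_zero]
    nlinarith
  · have hy' : 0 < y := lt_of_le_of_ne hy fun h0 => hx'.ne' (h h0.symm)
    -- The bound `log u ≤ u - 1` at `u = s * y / x`, multiplied by `x`, is the claim.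
    have h1 := Real.log_le_sub_one_of_pos (x := s * y / x) (by positivity)
    rw [Real.log_div (by positivity) (by positivity), Real.log_mul (by positivity) (by positivity)]
      at h1
    rw [entTerm, Real.log_div (by positivity) (by positivity)]
    have h2 : x * (Real.log s + Real.log y - Real.log x) ≤ x * (s * y / x - 1) :=
      mul_le_mul_of_nonneg_left h1 hx
    have h3 : x * (s * y / x - 1) = s * y - x := by field_simp
    nlinarith

/-- This homogeneity moves cell probabilities in and out of the divergence without normalizing the
densities. -/
lemma relEnt_mul {c : ℝ} (hc : 0 ≤ c) (x y : ℝ) :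
    relEnt (c * x) (c * y) = ENNReal.ofReal c * relEnt x y := by
  rcases hc.eq_or_lt with rfl | hc'
  · simp
  by_cases h : y = 0 ∧ x ≠ 0
  · obtain ⟨rfl, hx⟩ := h
    rw [mul_zero, relEnt_zero_right hx, relEnt_zero_right (mul_ne_zero hc'.ne' hx),
      ENNReal.mul_top (by simpa using hc')]
  · have h' : y = 0 → x = 0 := by tauto
    rw [relEnt_of_imp h', relEnt_of_imp (by simpa [hc'.ne'] using h'), ← ENNReal.ofReal_mul hc,
      entTerm, entTerm, mul_div_mul_left _ _ hc'.ne']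
    ring_nf

/-- The log-sum inequality. -/
lemma relEnt_sum_le {κ : Type*} (s : Finset κ) (x y : κ → ℝ) (hx : ∀ k ∈ s, 0 ≤ x k)
    (hy : ∀ k ∈ s, 0 ≤ y k) :
    relEnt (∑ k ∈ s, x k) (∑ k ∈ s, y k) ≤ ∑ k ∈ s, relEnt (x k) (y k) := by
  by_cases htop : ∑ k ∈ s, relEnt (x k) (y k) = ∞
  · rw [htop]; exact le_top
  have hk : ∀ k ∈ s, y k = 0 → x k = 0 := fun k hk =>
    imp_of_relEnt_ne_top ((ENNReal.sum_ne_top.1 htop) k hk)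
  have hX : 0 ≤ ∑ k ∈ s, x k := Finset.sum_nonneg hx
  have hY : 0 ≤ ∑ k ∈ s, y k := Finset.sum_nonneg hy
  have hXY : ∑ k ∈ s, y k = 0 → ∑ k ∈ s, x k = 0 := fun h =>
    Finset.sum_eq_zero fun k hk' => hk k hk' ((Finset.sum_eq_zero_iff_of_nonneg hy).1 h k hk')
  rw [relEnt_of_imp hXY, Finset.sum_congr rfl fun k hk' => relEnt_of_imp (hk k hk'),
    ← ENNReal.ofReal_sum_of_nonneg fun k hk' => entTerm_nonneg (hx k hk') (hy k hk') (hk k hk')]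
  apply ENNReal.ofReal_le_ofReal
  rcases hX.eq_or_lt with h0 | hpos
  · have hx0 := (Finset.sum_eq_zero_iff_of_nonneg hx).1 h0.symm
    rw [← h0, entTerm]
    simp only [zero_mul, zero_add, sub_zero]
    refine Finset.sum_le_sum fun k hk' => ?_
    simp [entTerm, hx0 k hk']
  · have hYpos : 0 < ∑ k ∈ s, y k := lt_of_le_of_ne hY fun h => hpos.ne' (hXY h.symm)
    set X := ∑ k ∈ s, x k
    set Y := ∑ k ∈ s, y k
    -- The tangent at the ratio `X / Y` is linear in `(x, y)` and exact at `(X, Y)`, so summing it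
    -- over `k` loses nothing on the left.
    calc entTerm X Y = X * Real.log (X / Y) + Y * (1 - X / Y) := by
          rw [entTerm]; field_simp; ring
      _ = ∑ k ∈ s, (x k * Real.log (X / Y) + y k * (1 - X / Y)) := by
          rw [Finset.sum_add_distrib, ← Finset.sum_mul, ← Finset.sum_mul]
      _ ≤ _ := Finset.sum_le_sum fun k hk' =>
          tangent_le_entTerm (hx k hk') (hy k hk') (hk k hk') (by positivity)

/-- The log-sum inequality for two terms; with homogeneity it is joint convexity. -/
lemma relEnt_add_le {x y x' y' : ℝ} (hx : 0 ≤ x) (hy : 0 ≤ y) (hx' : 0 ≤ x') (hy' : 0 ≤ y') :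
    relEnt (x + x') (y + y') ≤ relEnt x y + relEnt x' y' := by
  have := relEnt_sum_le Finset.univ ![x, x'] ![y, y'] (by simp [hx, hx'])
    (by simp [hy, hy'])
  simpa using this

/-- Among all `n`, the sum `∑ k, relEnt (x k) (v k * n)` is smallest for the total of `x`. -/
lemma sum_relEnt_mul_sum_le {κ : Type*} [Fintype κ] (x v : κ → ℝ) (hx : ∀ k, 0 ≤ x k)
    (hv : v ∈ stdSimplex ℝ κ) {n : ℝ} (hn : 0 ≤ n) :
    ∑ k, relEnt (x k) (v k * ∑ j, x j) ≤ ∑ k, relEnt (x k) (v k * n) := by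
  by_cases htop : ∑ k, relEnt (x k) (v k * n) = ∞
  · rw [htop]; exact le_top
  have hk : ∀ k, v k * n = 0 → x k = 0 := fun k =>
    imp_of_relEnt_ne_top ((ENNReal.sum_ne_top.1 htop) k (Finset.mem_univ _))
  have hX : 0 ≤ ∑ k, x k := Finset.sum_nonneg fun k _ => hx k
  rcases hX.eq_or_lt with h0 | hpos
  · have hx0 := (Finset.sum_eq_zero_iff_of_nonneg fun k _ => hx k).1 h0.symm
    rw [Finset.sum_eq_zero]
    · exact zero_le
    · intro k hk'
      simp [← h0, hx0 k hk']
  set X := ∑ k, x k with hXdef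
  have hn' : 0 < n := by
    refine lt_of_le_of_ne hn fun h => hpos.ne' (Finset.sum_eq_zero fun k _ => hk k ?_)
    rw [← h, mul_zero]
  have hv0 : ∀ k, v k = 0 → x k = 0 := fun k h => hk k (by rw [h, zero_mul])
  have hkX : ∀ k, v k * X = 0 → x k = 0 := fun k h => by
    rcases mul_eq_zero.1 h with h | h
    · exact hv0 k h
    · exact absurd h hpos.ne'
  rw [Finset.sum_congr rfl fun k _ => relEnt_of_imp (hk k),
    Finset.sum_congr rfl fun k _ => relEnt_of_imp (hkX k),
    ← ENNReal.ofReal_sum_of_nonneg fun k _ =>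
      entTerm_nonneg (hx k) (mul_nonneg (hv.1 k) hn) (hk k),
    ← ENNReal.ofReal_sum_of_nonneg fun k _ =>
      entTerm_nonneg (hx k) (mul_nonneg (hv.1 k) hX) (hkX k)]
  apply ENNReal.ofReal_le_ofReal
  -- Changing the scale from `X` to `n` costs a term that is linear in `x k` and `v k`; these costs
  -- add up to `entTerm X n`, which is nonnegative.
  have hterm : ∀ k, entTerm (x k) (v k * n) =
      entTerm (x k) (v k * X) + (x k * Real.log (X / n) + v k * (n - X)) := by
    intro k
    rcases (hx k).eq_or_lt with h | h
    · simp [entTerm, ← h]; ring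
    · have hvk : 0 < v k := lt_of_le_of_ne (hv.1 k) fun h' => h.ne' (hv0 k h'.symm)
      rw [entTerm, entTerm, Real.log_div h.ne' (by positivity), Real.log_div h.ne' (by positivity),
        Real.log_mul hvk.ne' hn'.ne', Real.log_mul hvk.ne' hpos.ne',
        Real.log_div hpos.ne' hn'.ne']
      ring
  have hnn := entTerm_nonneg hX hn (fun h => absurd h hn'.ne')
  rw [Finset.sum_congr rfl fun k _ => hterm k, Finset.sum_add_distrib]
  have : ∑ k, (x k * Real.log (X / n) + v k * (n - X)) = entTerm X n := by
    rw [Finset.sum_add_distrib, ← Finset.sum_mul, ← Finset.sum_mul, hv.2, entTerm, ← hXdef]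
    ring
  linarith

/-- The divergence of a normalized finite distribution, in terms of `relEnt`. -/
lemma ofReal_mul_finKL {κ : Type*} [Fintype κ] (x ρ : κ → ℝ) (hx : ∀ k, 0 ≤ x k)
    (hρ : ρ ∈ stdSimplex ℝ κ) :
    ENNReal.ofReal (∑ j, x j) * finKL (fun k => x k / ∑ j, x j) ρ =
      ∑ k, relEnt (x k) (ρ k * ∑ j, x j) := by
  have hX : 0 ≤ ∑ k, x k := Finset.sum_nonneg fun k _ => hx k
  -- For total mass zero the normalized vector is `0` by division by zero; the factor `0` makes its
  -- divergence irrelevant.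
  rcases hX.eq_or_lt with h0 | hpos
  · have hx0 := (Finset.sum_eq_zero_iff_of_nonneg fun k _ => hx k).1 h0.symm
    rw [Finset.sum_eq_zero (f := fun k => relEnt _ _)]
    · simp [← h0]
    · intro k hk'
      simp [← h0, hx0 k hk']
  set X := ∑ k, x k with hXdef
  rw [finKL]
  split_ifs with h
  · obtain ⟨k, hk, hk'⟩ := h
    rw [ENNReal.mul_top (by simpa using hpos), eq_comm, ENNReal.sum_eq_top]
    refine ⟨k, Finset.mem_univ _, ?_⟩
    rw [hk, zero_mul]
    exact relEnt_zero_right fun h => hk' (by rw [h, zero_div])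
  · have hρ0 : ∀ k, ρ k = 0 → x k = 0 := by
      intro k hk
      by_contra hne
      exact h ⟨k, hk, div_ne_zero hne hpos.ne'⟩
    have hkX : ∀ k, ρ k * X = 0 → x k = 0 := fun k h => by
      rcases mul_eq_zero.1 h with h | h
      · exact hρ0 k h
      · exact absurd h hpos.ne'
    rw [Finset.sum_congr rfl fun k _ => relEnt_of_imp (hkX k), ← ENNReal.ofReal_mul hX,
      ← ENNReal.ofReal_sum_of_nonneg fun k _ =>
        entTerm_nonneg (hx k) (mul_nonneg (hρ.1 k) hX) (hkX k)]
    congr 1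
    -- The corrections `y - x` cancel in the sum because `ρ` has total mass one.
    simp only [entTerm]
    rw [Finset.sum_sub_distrib, Finset.sum_add_distrib, ← Finset.sum_mul, hρ.2, ← hXdef,
      Finset.mul_sum, one_mul, add_sub_cancel_right]
    refine Finset.sum_congr rfl fun k _ => ?_
    rw [div_div, mul_comm X (ρ k)]
    field_simp

lemma measurable_relEnt {O : Type*} [MeasurableSpace O] {f g : O → ℝ} (hf : Measurable f)
    (hg : Measurable g) : Measurable fun o => relEnt (f o) (g o) := by
  unfold relEnt entTerm
  refine Measurable.ite ?_ measurable_const ?_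
  · exact (hg (measurableSet_singleton 0)).inter (hf (measurableSet_singleton 0)).compl
  · fun_prop

/-- The Kullback-Leibler divergence in terms of densities. -/
lemma klDiv_withDensity {O : Type*} [MeasurableSpace O] (μ : Measure O) [IsFiniteMeasure μ]
    {f g : O → ℝ} (hf : Measurable f) (hg : Measurable g) (hf0 : ∀ o, 0 ≤ f o) (hg0 : ∀ o, 0 ≤ g o)
    [IsFiniteMeasure (μ.withDensity fun o => ENNReal.ofReal (f o))]
    [IsFiniteMeasure (μ.withDensity fun o => ENNReal.ofReal (g o))] :
    klDiv (μ.withDensity fun o => ENNReal.ofReal (f o))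
      (μ.withDensity fun o => ENNReal.ofReal (g o)) = ∫⁻ o, relEnt (f o) (g o) ∂μ := by
  by_cases h : ∀ᵐ o ∂μ, g o = 0 → f o = 0
  · have hfg : μ.withDensity (fun o => ENNReal.ofReal (f o)) =
        (μ.withDensity fun o => ENNReal.ofReal (g o)).withDensity
          fun o => ENNReal.ofReal (f o / g o) := by
      rw [← withDensity_mul _ (by fun_prop) (by fun_prop)]
      refine withDensity_congr_ae ?_
      filter_upwards [h] with o ho
      simp only [Pi.mul_apply]
      rw [← ENNReal.ofReal_mul (hg0 o)]
      by_cases hgo : g o = 0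
      · simp [hgo, ho hgo]
      · rw [mul_div_cancel₀ _ hgo]
    have hac : μ.withDensity (fun o => ENNReal.ofReal (f o)) ≪
        μ.withDensity fun o => ENNReal.ofReal (g o) := by
      rw [hfg]; exact withDensity_absolutelyContinuous _ _
    rw [klDiv_eq_lintegral_klFun_of_ac hac, hfg]
    have hd := Measure.rnDeriv_withDensity (μ.withDensity fun o => ENNReal.ofReal (g o))
      (f := fun o => ENNReal.ofReal (f o / g o)) (by fun_prop)
    have : ∀ᵐ o ∂(μ.withDensity fun o => ENNReal.ofReal (g o)),
        ENNReal.ofReal (klFun (((μ.withDensity fun o => ENNReal.ofReal (g o)).withDensity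
          fun o => ENNReal.ofReal (f o / g o)).rnDeriv
          (μ.withDensity fun o => ENNReal.ofReal (g o)) o).toReal) =
        ENNReal.ofReal (klFun (f o / g o)) := by
      filter_upwards [hd] with o ho
      rw [ho, ENNReal.toReal_ofReal (div_nonneg (hf0 o) (hg0 o))]
    have hm : Measurable fun o => ENNReal.ofReal (klFun (f o / g o)) :=
      ENNReal.measurable_ofReal.comp (measurable_klFun.comp (hf.div hg))
    rw [lintegral_congr_ae this, lintegral_withDensity_eq_lintegral_mul _ (by fun_prop) hm]
    refine lintegral_congr_ae ?_
    filter_upwards [h] with o ho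
    rw [relEnt_of_imp ho, entTerm_eq_mul_klFun ho, ENNReal.ofReal_mul (hg0 o)]
    rfl
  · have hA : MeasurableSet {o | g o = 0} := hg (measurableSet_singleton 0)
    have hB : MeasurableSet {o | f o = 0} := hf (measurableSet_singleton 0)
    -- Absolute continuity fails exactly because this set has positive measure; the integrand is `∞`
    -- on it, so both sides are infinite.
    have hne : μ ({o | g o = 0} ∩ {o | f o = 0}ᶜ) ≠ 0 := by
      intro h0
      apply h
      rw [ae_iff]
      convert h0 using 2
      ext o
      simp
    rw [klDiv_of_not_ac, eq_comm]
    · refine ENNReal.eq_top_of_forall_nnreal_le fun r => ?_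
      have hle : ∫⁻ o in {o | g o = 0} ∩ {o | f o = 0}ᶜ, ∞ ∂μ ≤ ∫⁻ o, relEnt (f o) (g o) ∂μ := by
        refine le_trans (setLIntegral_mono' (hA.inter hB.compl) fun o ho => ?_)
          (setLIntegral_le_lintegral _ _)
        obtain ⟨h1, h2⟩ := ho
        rw [show g o = 0 from h1, relEnt_zero_right h2]
      rw [lintegral_const, Measure.restrict_apply_univ, ENNReal.top_mul hne] at hle
      exact le_top.trans hle
    · intro hac
      have h1 : (μ.withDensity fun o => ENNReal.ofReal (g o)) ({o | g o = 0} ∩ {o | f o = 0}ᶜ)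
          = 0 := by
        rw [withDensity_apply _ (hA.inter hB.compl),
          setLIntegral_congr_fun (g := fun _ => 0) (hA.inter hB.compl), lintegral_zero]
        intro o ho
        simp [show g o = 0 from ho.1]
      have h2 := hac h1
      rw [withDensity_apply_eq_zero (by fun_prop)] at h2
      apply hne
      convert h2 using 2
      ext o
      simp only [Set.mem_inter_iff, Set.mem_ofPred_eq, Set.mem_compl_iff, ne_eq,
        ENNReal.ofReal_eq_zero, not_le]
      have := hf0 o
      constructor
      · rintro ⟨ha, hb⟩
        exact ⟨lt_of_le_of_ne this (Ne.symm hb), ha, hb⟩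
      · rintro ⟨_, hb⟩
        exact hb

/-- Among all multiples of the second density, the divergence is smallest for the one whose mass
is that of the first density. -/
lemma lintegral_relEnt_mul_le {O : Type*} [MeasurableSpace O] (μ : Measure O)
    {f g : O → ℝ} (hf : Measurable f) (hg : Measurable g) (hf0 : ∀ o, 0 ≤ f o) (hg0 : ∀ o, 0 ≤ g o)
    {v r : ℝ} (hv : 0 ≤ v) (hr : 0 ≤ r) (hfv : ∫⁻ o, ENNReal.ofReal (f o) ∂μ = ENNReal.ofReal v)
    (hg1 : ∫⁻ o, ENNReal.ofReal (g o) ∂μ = 1) :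
    ∫⁻ o, relEnt (f o) (v * g o) ∂μ ≤ ∫⁻ o, relEnt (f o) (r * g o) ∂μ := by
  rcases hv.eq_or_lt with rfl | hv'
  · have : ∀ᵐ o ∂μ, relEnt (f o) (0 * g o) = 0 := by
      rw [ENNReal.ofReal_zero, lintegral_eq_zero_iff (by fun_prop)] at hfv
      filter_upwards [hfv] with o ho
      have : f o = 0 := le_antisymm (ENNReal.ofReal_eq_zero.1 ho) (hf0 o)
      simp [this]
    rw [lintegral_congr_ae this]
    simp
  rcases hr.eq_or_lt with rfl | hr'
  · have hle : ∫⁻ o, ∞ * ENNReal.ofReal (f o) ∂μ ≤ ∫⁻ o, relEnt (f o) (0 * g o) ∂μ := by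
      refine lintegral_mono fun o => ?_
      by_cases h : f o = 0
      · simp [h]
      · simp [relEnt_zero_right h]
    rw [lintegral_const_mul _ (by fun_prop), hfv, ENNReal.top_mul (by simpa using hv')] at hle
    exact le_top.trans hle
  have hpt : ∀ o, relEnt (f o) (v * g o) +
      (ENNReal.ofReal (Real.log (v / r))  * ENNReal.ofReal (f o) +
        ENNReal.ofReal (r - v) * ENNReal.ofReal (g o)) =
      relEnt (f o) (r * g o) + (ENNReal.ofReal (- Real.log (v / r)) * ENNReal.ofReal (f o) +
        ENNReal.ofReal (v - r) * ENNReal.ofReal (g o)) := by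
    intro o
    by_cases h : g o = 0 ∧ f o ≠ 0
    · simp [h.1, relEnt_zero_right h.2]
    have h' : g o = 0 → f o = 0 := by tauto
    have hv0 : v * g o = 0 → f o = 0 := by simpa [hv'.ne'] using h'
    have hr0 : r * g o = 0 → f o = 0 := by simpa [hr'.ne'] using h'
    have key : entTerm (f o) (r * g o) =
        entTerm (f o) (v * g o) + (Real.log (v / r) * f o + (r - v) * g o) := by
      by_cases h0 : f o = 0
      · simp [entTerm, h0]; ring
      have hgo : g o ≠ 0 := fun h => h0 (h' h)
      rw [entTerm, entTerm, Real.log_div h0 (by positivity), Real.log_div h0 (by positivity),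
        Real.log_mul hv'.ne' hgo, Real.log_mul hr'.ne' hgo, Real.log_div hv'.ne' hr'.ne']
      ring
    have e1 := entTerm_nonneg (hf0 o) (mul_nonneg hv (hg0 o)) hv0
    have e2 := entTerm_nonneg (hf0 o) (mul_nonneg hr (hg0 o)) hr0
    have f0 := hf0 o
    have g0 := hg0 o
    rw [relEnt_of_imp hv0, relEnt_of_imp hr0]
    rcases le_total r v with hrv | hrv
    · have hl : 0 ≤ Real.log (v / r) := Real.log_nonneg ((one_le_div hr').2 hrv)
      rw [ENNReal.ofReal_of_nonpos (sub_nonpos.2 hrv), ENNReal.ofReal_of_nonpos (neg_nonpos.2 hl),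
        zero_mul, zero_mul, add_zero, zero_add, ← ENNReal.ofReal_mul hl,
        ← ENNReal.ofReal_mul (sub_nonneg.2 hrv), ← ENNReal.ofReal_add e1 (by positivity),
        ← ENNReal.ofReal_add e2 (mul_nonneg (sub_nonneg.2 hrv) g0)]
      congr 1
      rw [key]; ring
    · have hl : Real.log (v / r) ≤ 0 :=
        Real.log_nonpos (by positivity) ((div_le_one hr').2 hrv)
      rw [ENNReal.ofReal_of_nonpos (sub_nonpos.2 hrv), ENNReal.ofReal_of_nonpos hl,
        zero_mul, zero_mul, add_zero, zero_add, ← ENNReal.ofReal_mul (neg_nonneg.2 hl),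
        ← ENNReal.ofReal_mul (sub_nonneg.2 hrv),
        ← ENNReal.ofReal_add e1 (mul_nonneg (sub_nonneg.2 hrv) g0),
        ← ENNReal.ofReal_add e2 (mul_nonneg (neg_nonneg.2 hl) f0)]
      congr 1
      rw [key]; ring
  have hint := lintegral_congr (μ := μ) hpt
  rw [lintegral_add_right _ (by fun_prop), lintegral_add_right _ (by fun_prop),
    lintegral_add_right _ (by fun_prop), lintegral_add_right _ (by fun_prop),
    lintegral_const_mul _ (by fun_prop), lintegral_const_mul _ (by fun_prop),
    lintegral_const_mul _ (by fun_prop), lintegral_const_mul _ (by fun_prop), hfv, hg1,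
    mul_one, mul_one] at hint
  have hkl := entTerm_nonneg hv hr (fun h => absurd h hr'.ne')
  -- After integration the difference is `entTerm v r`, which is nonnegative.
  have hle : ENNReal.ofReal (- Real.log (v / r)) * ENNReal.ofReal v + ENNReal.ofReal (v - r) ≤
      ENNReal.ofReal (Real.log (v / r)) * ENNReal.ofReal v + ENNReal.ofReal (r - v) := by
    rw [entTerm] at hkl
    rcases le_total r v with hrv | hrv
    · have hl : 0 ≤ Real.log (v / r) := Real.log_nonneg ((one_le_div hr').2 hrv)
      rw [ENNReal.ofReal_of_nonpos (sub_nonpos.2 hrv), ENNReal.ofReal_of_nonpos (neg_nonpos.2 hl),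
        zero_mul, add_zero, zero_add, ← ENNReal.ofReal_mul hl]
      apply ENNReal.ofReal_le_ofReal
      linarith
    · have hl : Real.log (v / r) ≤ 0 :=
        Real.log_nonpos (by positivity) ((div_le_one hr').2 hrv)
      rw [ENNReal.ofReal_of_nonpos (sub_nonpos.2 hrv), ENNReal.ofReal_of_nonpos hl,
        zero_mul, add_zero, zero_add, ← ENNReal.ofReal_mul (neg_nonneg.2 hl)]
      apply ENNReal.ofReal_le_ofReal
      linarith
  have hfin : ENNReal.ofReal (Real.log (v / r)) * ENNReal.ofReal v + ENNReal.ofReal (r - v) ≠ ∞ := by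
    finiteness
  refine (ENNReal.add_le_add_iff_right hfin).1 ?_
  rw [hint]
  gcongr

end RelEnt

/-! ### Densities with respect to the sum of all observation laws -/

section Densities

variable {ι Pol O : Type*} [Fintype ι] [MeasurableSpace O]

/-- The measure with respect to which `density` is taken. -/
noncomputable def refMeasure (m : ι → Model Pol O) (π : Pol) : Measure O := ∑ j, (m j).law π

instance (m : ι → Model Pol O) (π : Pol) : IsFiniteMeasure (refMeasure m π) := by
  have := fun i => (m i).isProb π
  unfold refMeasure
  infer_instance

lemma density_nonneg (m : ι → Model Pol O) (i : ι) (π : Pol) (o : O) : 0 ≤ density m i π o :=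
  ENNReal.toReal_nonneg

@[fun_prop]
lemma measurable_density (m : ι → Model Pol O) (i : ι) (π : Pol) : Measurable (density m i π) :=
  (Measure.measurable_rnDeriv _ _).ennreal_toReal

lemma withDensity_density (m : ι → Model Pol O) (i : ι) (π : Pol) :
    (refMeasure m π).withDensity (fun o => ENNReal.ofReal (density m i π o)) = (m i).law π := by
  have := (m i).isProb π
  have hac : (m i).law π ≪ refMeasure m π := by
    refine Measure.absolutelyContinuous_of_le ?_
    exact Finset.single_le_sum (f := fun j => (m j).law π) (fun _ _ => Measure.zero_le _)
      (Finset.mem_univ i)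
  conv_rhs => rw [← Measure.withDensity_rnDeriv_eq _ _ hac]
  refine withDensity_congr_ae ?_
  filter_upwards [Measure.rnDeriv_ne_top ((m i).law π) (refMeasure m π)] with o ho
  exact ENNReal.ofReal_toReal ho

lemma lintegral_density (m : ι → Model Pol O) (i : ι) (π : Pol) :
    ∫⁻ o, ENNReal.ofReal (density m i π o) ∂(refMeasure m π) = 1 := by
  have := (m i).isProb π
  rw [← setLIntegral_univ, ← withDensity_apply _ MeasurableSet.univ, withDensity_density]
  exact measure_univ

lemma lintegral_sum_density {κ : Type*} (s : Finset κ) (m : ι → Model Pol O) (w : κ → ℝ)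
    (hw : ∀ k ∈ s, 0 ≤ w k) (i : κ → ι) (π : Pol) :
    ∫⁻ o, ENNReal.ofReal (∑ k ∈ s, w k * density m (i k) π o) ∂(refMeasure m π) =
      ENNReal.ofReal (∑ k ∈ s, w k) := by
  have : ∀ o, ENNReal.ofReal (∑ k ∈ s, w k * density m (i k) π o) =
      ∑ k ∈ s, ENNReal.ofReal (w k) * ENNReal.ofReal (density m (i k) π o) := fun o => by
    rw [ENNReal.ofReal_sum_of_nonneg fun k hk => mul_nonneg (hw k hk) (density_nonneg _ _ _ _)]
    exact Finset.sum_congr rfl fun k hk => ENNReal.ofReal_mul (hw k hk)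
  simp_rw [this]
  rw [lintegral_finsetSum _ (by fun_prop), ENNReal.ofReal_sum_of_nonneg hw]
  refine Finset.sum_congr rfl fun k _ => ?_
  rw [lintegral_const_mul _ (by fun_prop), lintegral_density, mul_one]

/-- The law of a mixture, by its density. -/
lemma sum_smul_law {κ : Type*} [Fintype κ] (m : ι → Model Pol O) (w : κ → ℝ)
    (hw : ∀ k, 0 ≤ w k) (i : κ → ι) (π : Pol) :
    ∑ k, ENNReal.ofReal (w k) • (m (i k)).law π = (refMeasure m π).withDensity
      (fun o => ENNReal.ofReal (∑ k, w k * density m (i k) π o)) := by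
  ext s hs
  rw [withDensity_apply _ hs]
  have : ∀ o, ENNReal.ofReal (∑ k, w k * density m (i k) π o) =
      ∑ k, ENNReal.ofReal (w k) * ENNReal.ofReal (density m (i k) π o) := fun o => by
    rw [ENNReal.ofReal_sum_of_nonneg fun k _ => mul_nonneg (hw k) (density_nonneg _ _ _ _)]
    exact Finset.sum_congr rfl fun k _ => ENNReal.ofReal_mul (hw k)
  simp_rw [this]
  rw [lintegral_finsetSum _ (by fun_prop), Measure.coe_finsetSum, Finset.sum_apply]
  refine Finset.sum_congr rfl fun k _ => ?_
  rw [lintegral_const_mul _ (by fun_prop), ← withDensity_apply _ hs, withDensity_density]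
  rfl

/-- The density of the observation on the event that the pair lies in the cell `φ`. -/
noncomputable def cellDensity (m : ι → Model Pol O) (ν : ι × Pol → ℝ) (π : Pol)
    (φ : Finset (ι × Pol)) (o : O) : ℝ :=
  ∑ ψ ∈ φ, ν ψ * density m ψ.1 π o

lemma cellDensity_nonneg (m : ι → Model Pol O) {ν : ι × Pol → ℝ} (hν : ∀ ψ, 0 ≤ ν ψ) (π : Pol)
    (φ : Finset (ι × Pol)) (o : O) : 0 ≤ cellDensity m ν π φ o :=
  Finset.sum_nonneg fun ψ _ => mul_nonneg (hν ψ) (density_nonneg _ _ _ _)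

@[fun_prop]
lemma measurable_cellDensity (m : ι → Model Pol O) (ν : ι × Pol → ℝ) (π : Pol)
    (φ : Finset (ι × Pol)) : Measurable (cellDensity m ν π φ) := by
  unfold cellDensity
  fun_prop

lemma lintegral_cellDensity (m : ι → Model Pol O) {ν : ι × Pol → ℝ} (hν : ∀ ψ, 0 ≤ ν ψ) (π : Pol)
    (φ : Finset (ι × Pol)) :
    ∫⁻ o, ENNReal.ofReal (cellDensity m ν π φ o) ∂(refMeasure m π) =
      ENNReal.ofReal (∑ ψ ∈ φ, ν ψ) :=
  lintegral_sum_density φ m ν (fun ψ _ => hν ψ) Prod.fst π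

end Densities

/-! ### Mixtures and hulls of models -/

section Mixtures

variable {Pol O : Type*} [MeasurableSpace O]

lemma Model.ext_of {M N : Model Pol O} (h1 : M.law = N.law) (h2 : M.value = N.value) : M = N := by
  cases M; cases N
  cases h1; cases h2
  rfl

/-- A mixture belongs to the hull of `S` if its components of positive weight belong to `S`. -/
lemma mixture_mem_co {κ : Type*} [Fintype κ] {S : Set (Model Pol O)} (w : κ → ℝ)
    (hw : w ∈ stdSimplex ℝ κ) (m : κ → Model Pol O) (h : ∀ k, w k ≠ 0 → m k ∈ S) :
    mixture w hw m ∈ co S := by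
  classical
  obtain ⟨k₀, hk₀⟩ : ∃ k, w k ≠ 0 := by
    by_contra! hall
    have := hw.2
    simp [hall] at this
  let e := (Fintype.equivFin κ).symm
  -- `co` asks every component to lie in `S`, so components of weight zero are replaced by one of
  -- positive weight.
  refine ⟨Fintype.card κ, w ∘ e, ⟨fun k => hw.1 _, ?_⟩,
    fun k => if w (e k) ≠ 0 then m (e k) else m k₀, ?_, ?_⟩
  · rw [← hw.2]
    exact Equiv.sum_comp e w
  · intro k
    dsimp only
    split_ifs with hk
    · exact h _ hk
    · exact h _ hk₀
  · refine Model.ext_of (funext fun π => ?_) (funext fun π => ?_)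
    · simp only [mixture]
      rw [← Equiv.sum_comp e]
      refine Finset.sum_congr rfl fun k _ => ?_
      by_cases hk : w (e k) = 0
      · simp [hk]
      · simp [hk]
    · simp only [mixture]
      rw [← Equiv.sum_comp e]
      refine Finset.sum_congr rfl fun k _ => ?_
      by_cases hk : w (e k) = 0
      · simp [hk]
      · simp [hk]

lemma subset_co (S : Set (Model Pol O)) : S ⊆ co S := by
  intro M hM
  have := mixture_mem_co (κ := Unit) (S := S) (fun _ => 1) ⟨fun _ => zero_le_one, by simp⟩
    (fun _ => M) (fun _ _ => hM)
  convert this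
  refine Model.ext_of (funext fun π => ?_) (funext fun π => ?_) <;> simp [mixture]

lemma Model.value_le_opt [Finite Pol] [Nonempty Pol] (M : Model Pol O) (π : Pol) :
    M.value π ≤ M.value M.opt :=
  (Finite.exists_max M.value).choose_spec π

end Mixtures

/-! ### Passing from extended to real values of the objective -/

section Offset

variable {Pol : Type*} [Fintype Pol]

lemma offset_eq_bot {η : ℝ} (hη : 0 < η) {p g : Pol → ℝ} {D : Pol → ℝ≥0∞}
    (h : ∑ π, ENNReal.ofReal (p π) * D π = ∞) : offset η p g D = ⊥ := by
  have h' : ENNReal.ofReal (1 / η) ≠ 0 := by simpa using hη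
  rw [offset, h, ENNReal.mul_top h', EReal.coe_ennreal_top, EReal.sub_top]

lemma offset_eq_coe {η : ℝ} (hη : 0 < η) {p g : Pol → ℝ} {D : Pol → ℝ≥0∞}
    (h : ∑ π, ENNReal.ofReal (p π) * D π ≠ ∞) :
    offset η p g D =
      ((∑ π, p π * g π - (∑ π, ENNReal.ofReal (p π) * D π).toReal / η : ℝ) : EReal) := by
  have h' : ENNReal.ofReal (1 / η) * ∑ π, ENNReal.ofReal (p π) * D π =
      ENNReal.ofReal ((∑ π, ENNReal.ofReal (p π) * D π).toReal / η) := by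
    rw [one_div, div_eq_inv_mul, ENNReal.ofReal_mul (by positivity), ENNReal.ofReal_toReal h]
  rw [offset, h', EReal.coe_ennreal_ofReal, max_eq_left (by positivity), EReal.coe_sub]

/-- The hypothesis on `D` says that gain minus divergence over `η` is at least `z`, in a form that
also forces every divergence to be finite. -/
lemma le_offset {η : ℝ} (hη : 0 < η) {p g z : Pol → ℝ} {D : Pol → ℝ≥0∞}
    (hp : ∀ π, 0 ≤ p π) (hz : ∀ π, z π ≤ g π)
    (hD : ∀ π, D π ≤ ENNReal.ofReal (η * (g π - z π))) :
    ((∑ π, p π * z π : ℝ) : EReal) ≤ offset η p g D := by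
  have hle : ∑ π, ENNReal.ofReal (p π) * D π ≤
      ENNReal.ofReal (∑ π, p π * (η * (g π - z π))) := by
    rw [ENNReal.ofReal_sum_of_nonneg fun π _ =>
      mul_nonneg (hp π) (mul_nonneg hη.le (sub_nonneg.2 (hz π)))]
    refine Finset.sum_le_sum fun π _ => ?_
    rw [ENNReal.ofReal_mul (hp π)]
    gcongr
    exact hD π
  rw [offset_eq_coe hη (ne_top_of_le_ne_top ENNReal.ofReal_ne_top hle), EReal.coe_le_coe_iff]
  have h1 := ENNReal.toReal_le_of_le_ofReal (Finset.sum_nonneg fun π _ =>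
      mul_nonneg (hp π) (mul_nonneg hη.le (sub_nonneg.2 (hz π)))) hle
  have h2 : ∑ π, p π * (η * (g π - z π)) = η * (∑ π, p π * g π - ∑ π, p π * z π) := by
    rw [← Finset.sum_sub_distrib, Finset.mul_sum]
    exact Finset.sum_congr rfl fun π _ => by ring
  rw [h2] at h1
  have h3 : (∑ π, ENNReal.ofReal (p π) * D π).toReal / η ≤ ∑ π, p π * g π - ∑ π, p π * z π := by
    rw [div_le_iff₀ hη]; linarith
  linarith

end Offset

/-! ### The information term in terms of cell densities -/

section Cells

variable {ι Pol O : Type*} [Fintype ι] [Fintype Pol] [MeasurableSpace O]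

/-- The expected regret of `π` when the pair (model, comparator) is drawn from `ν`. -/
def gain (m : ι → Model Pol O) (ν : ι × Pol → ℝ) (π : Pol) : ℝ :=
  ∑ ψ, ν ψ * ((m ψ.1).value ψ.2 - (m ψ.1).value π)

lemma gain_eq (m : ι → Model Pol O) (ν : ι × Pol → ℝ) (hν : ν ∈ stdSimplex ℝ (ι × Pol)) (π : Pol) :
    gain m ν π = comparatorValue m ν - (mix m ν hν).value π := by
  simp only [gain, comparatorValue, mix, mixture, mul_sub, Finset.sum_sub_distrib]

lemma gain_le_one (m : ι → Model Pol O) (ν : ι × Pol → ℝ) (hν : ν ∈ stdSimplex ℝ (ι × Pol))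
    (π : Pol) : gain m ν π ≤ 1 := by
  rw [← hν.2]
  refine Finset.sum_le_sum fun ψ _ => mul_le_of_le_one_right (hν.1 ψ) ?_
  have h1 := ((m ψ.1).value_mem ψ.2).2
  have h2 := ((m ψ.1).value_mem π).1
  linarith

lemma mix_law (m : ι → Model Pol O) (ν : ι × Pol → ℝ) (hν : ν ∈ stdSimplex ℝ (ι × Pol)) (π : Pol) :
    (mix m ν hν).law π = (refMeasure m π).withDensity
      fun o => ENNReal.ofReal (cellDensity m ν π Finset.univ o) :=
  sum_smul_law m ν hν.1 Prod.fst π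

lemma sum_eq_sum_of_distOn {φ : Finset (ι × Pol)} {ν : ι × Pol → ℝ} (hν : ν ∈ distOn φ)
    (f : ι × Pol → ℝ) : ∑ ψ, ν ψ * f ψ = ∑ ψ ∈ φ, ν ψ * f ψ := by
  rw [← Finset.sum_subset (Finset.subset_univ φ)]
  intro ψ _ h
  rw [hν.2 ψ h, zero_mul]

/-- A distribution on the union of the cells splits into its parts on the cells. -/
lemma sum_eq_sum_cells [DecidableEq ι] [DecidableEq Pol] {Φ : Finset (Finset (ι × Pol))}
    (hΦ : (Φ : Set (Finset (ι × Pol))).PairwiseDisjoint id) {ν : ι × Pol → ℝ}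
    (hν : ν ∈ distOn (Φ.biUnion id)) (f : ι × Pol → ℝ) :
    ∑ ψ, ν ψ * f ψ = ∑ φ : Φ, ∑ ψ ∈ φ.1, ν ψ * f ψ := by
  rw [sum_eq_sum_of_distOn hν, Finset.sum_biUnion hΦ,
    Finset.sum_coe_sort Φ (fun φ => ∑ ψ ∈ φ, ν ψ * f ψ)]
  rfl

lemma cellMass_mem_stdSimplex [DecidableEq ι] [DecidableEq Pol] {Φ : Finset (Finset (ι × Pol))}
    (hΦ : (Φ : Set (Finset (ι × Pol))).PairwiseDisjoint id) {ν : ι × Pol → ℝ}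
    (hν : ν ∈ distOn (Φ.biUnion id)) :
    (fun φ : Φ => ∑ ψ ∈ φ.1, ν ψ) ∈ stdSimplex ℝ Φ := by
  refine ⟨fun φ => Finset.sum_nonneg fun ψ _ => hν.1.1 ψ, ?_⟩
  have := sum_eq_sum_cells hΦ hν (fun _ => 1)
  simp only [mul_one] at this
  rw [← this, hν.1.2]

lemma cellDensity_univ [DecidableEq ι] [DecidableEq Pol] {Φ : Finset (Finset (ι × Pol))}
    (hΦ : (Φ : Set (Finset (ι × Pol))).PairwiseDisjoint id) {ν : ι × Pol → ℝ}
    (hν : ν ∈ distOn (Φ.biUnion id)) (m : ι → Model Pol O) (π : Pol) (o : O) :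
    cellDensity m ν π Finset.univ o = ∑ φ : Φ, cellDensity m ν π φ.1 o :=
  sum_eq_sum_cells hΦ hν _

lemma measurable_finKL {κ : Type*} [Fintype κ] {f : O → κ → ℝ} (hf : ∀ k, Measurable fun o => f o k)
    (b : κ → ℝ) : Measurable fun o => finKL (f o) b := by
  classical
  unfold finKL
  refine Measurable.ite ?_ measurable_const (by fun_prop)
  have : {o | ∃ k, b k = 0 ∧ f o k ≠ 0} = ⋃ k, {o | b k = 0 ∧ f o k ≠ 0} := by
    ext o; simp
  rw [this]
  refine MeasurableSet.iUnion fun k => ?_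
  by_cases hb : b k = 0
  · simp only [hb, true_and]
    exact (hf k (measurableSet_singleton 0)).compl
  · simp [hb]

/-- The expected divergence of the posterior over cells, in terms of densities. -/
lemma sum_lintegral_finKL_posterior [DecidableEq ι] [DecidableEq Pol]
    {Φ : Finset (Finset (ι × Pol))}
    (hΦ : (Φ : Set (Finset (ι × Pol))).PairwiseDisjoint id) {ν : ι × Pol → ℝ}
    (hν : ν ∈ distOn (Φ.biUnion id)) (m : ι → Model Pol O) {ρ : Φ → ℝ} (hρ : ρ ∈ stdSimplex ℝ Φ)
    (π : Pol) :
    ∑ ψ, ENNReal.ofReal (ν ψ) * ∫⁻ o, finKL (posterior m Φ ν π o) ρ ∂((m ψ.1).law π) =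
      ∑ φ : Φ, ∫⁻ o, relEnt (cellDensity m ν π φ.1 o)
        (ρ φ * cellDensity m ν π Finset.univ o) ∂(refMeasure m π) := by
  have hpost : ∀ o, posterior m Φ ν π o =
      fun φ : Φ => cellDensity m ν π φ.1 o / ∑ φ' : Φ, cellDensity m ν π φ'.1 o := by
    intro o
    funext φ
    rw [posterior, Finset.sum_coe_sort Φ (fun φ => cellDensity m ν π φ o)]
    rfl
  have hmeas : Measurable fun o => finKL (posterior m Φ ν π o) ρ := by
    refine measurable_finKL (fun φ => ?_) ρ
    simp_rw [hpost]
    fun_prop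
  have hlaw := mix_law m ν hν.1 π
  calc _ = ∫⁻ o, finKL (posterior m Φ ν π o) ρ ∂((mix m ν hν.1).law π) := by
        simp only [mix, mixture]
        rw [lintegral_finsetSum_measure]
        refine Finset.sum_congr rfl fun ψ _ => ?_
        rw [lintegral_smul_measure, smul_eq_mul]
    _ = ∫⁻ o, ENNReal.ofReal (cellDensity m ν π Finset.univ o) *
          finKL (posterior m Φ ν π o) ρ ∂(refMeasure m π) := by
        rw [hlaw, lintegral_withDensity_eq_lintegral_mul _ (by fun_prop) hmeas]
        rfl
    _ = ∫⁻ o, ∑ φ : Φ, relEnt (cellDensity m ν π φ.1 o)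
        (ρ φ * cellDensity m ν π Finset.univ o) ∂(refMeasure m π) := by
        refine lintegral_congr fun o => ?_
        rw [hpost, cellDensity_univ hΦ hν]
        exact ofReal_mul_finKL _ _ (fun φ => cellDensity_nonneg m hν.1.1 π φ.1 o) hρ
    _ = _ := by
        rw [lintegral_finsetSum]
        intro φ _
        exact measurable_relEnt (by fun_prop) (by fun_prop)

end Cells

/-! ### Upper bounds on the AIR value -/

section Upper

variable {ι Pol O : Type*} [Fintype ι] [Fintype Pol] [DecidableEq ι] [DecidableEq Pol]
  [MeasurableSpace O]

/-- The distribution `ν`, conditioned on the cell `φ`. -/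
noncomputable def condDist (ν : ι × Pol → ℝ) (φ : Finset (ι × Pol)) (ψ : ι × Pol) : ℝ :=
  if ψ ∈ φ then ν ψ / ∑ ψ' ∈ φ, ν ψ' else 0

omit [Fintype ι] [Fintype Pol] in
lemma mul_condDist {ν : ι × Pol → ℝ} (hν : ∀ ψ, 0 ≤ ν ψ) {φ : Finset (ι × Pol)} {ψ : ι × Pol}
    (hψ : ψ ∈ φ) : (∑ ψ' ∈ φ, ν ψ') * condDist ν φ ψ = ν ψ := by
  rw [condDist, if_pos hψ]
  by_cases h : ∑ ψ' ∈ φ, ν ψ' = 0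
  · rw [h, (Finset.sum_eq_zero_iff_of_nonneg fun ψ _ => hν ψ).1 h ψ hψ, zero_mul]
  · rw [mul_div_cancel₀ _ h]

lemma mul_sum_condDist {ν : ι × Pol → ℝ} (hν : ∀ ψ, 0 ≤ ν ψ) (φ : Finset (ι × Pol))
    (f : ι × Pol → ℝ) :
    (∑ ψ ∈ φ, ν ψ) * ∑ ψ, condDist ν φ ψ * f ψ = ∑ ψ ∈ φ, ν ψ * f ψ := by
  rw [← Finset.sum_subset (Finset.subset_univ φ), Finset.mul_sum]
  · refine Finset.sum_congr rfl fun ψ hψ => ?_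
    rw [← mul_assoc, mul_condDist hν hψ]
  · intro ψ _ h
    rw [condDist, if_neg h, zero_mul]

lemma condDist_mem_distOn {ν : ι × Pol → ℝ} (hν : ∀ ψ, 0 ≤ ν ψ) {φ : Finset (ι × Pol)}
    (hφ : 0 < ∑ ψ ∈ φ, ν ψ) : condDist ν φ ∈ distOn φ := by
  refine ⟨⟨fun ψ => ?_, ?_⟩, fun ψ h => if_neg h⟩
  · rw [condDist]
    split_ifs
    · exact div_nonneg (hν ψ) hφ.le
    · exact le_rfl
  · have := mul_sum_condDist hν φ fun _ => 1
    simp only [mul_one] at this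
    exact mul_left_cancel₀ hφ.ne' (by rw [this, mul_one])

/-- The divergence between the mixtures under the conditional distribution on a cell and under
the whole distribution, weighted by the probability of the cell. -/
lemma ofReal_mul_klDiv_mix_condDist (m : ι → Model Pol O) {ν : ι × Pol → ℝ}
    (hν : ν ∈ stdSimplex ℝ (ι × Pol)) {φ : Finset (ι × Pol)}
    (hφ : condDist ν φ ∈ stdSimplex ℝ (ι × Pol)) (π : Pol) :
    ENNReal.ofReal (∑ ψ ∈ φ, ν ψ) * klDiv ((mix m _ hφ).law π) ((mix m ν hν).law π) =
      ∫⁻ o, relEnt (cellDensity m ν π φ o)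
        ((∑ ψ ∈ φ, ν ψ) * cellDensity m ν π Finset.univ o) ∂(refMeasure m π) := by
  have hv : 0 ≤ ∑ ψ ∈ φ, ν ψ := Finset.sum_nonneg fun ψ _ => hν.1 ψ
  have h1 := (mix m _ hφ).isProb π
  have h2 := (mix m _ hν).isProb π
  rw [mix_law] at h1 h2 ⊢
  rw [mix_law, klDiv_withDensity _ (by fun_prop) (by fun_prop)
    (fun o => cellDensity_nonneg m hφ.1 π _ o) (fun o => cellDensity_nonneg m hν.1 π _ o),
    ← lintegral_const_mul _ (measurable_relEnt (by fun_prop) (by fun_prop))]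
  refine lintegral_congr fun o => ?_
  rw [← relEnt_mul hv]
  congr 1
  exact mul_sum_condDist hν.1 φ _

/-- Some cell does at least as well as the whole distribution `ν`, if the reference model is the
mixture under `ν`. -/
theorem exists_cell_AIR_le_offset {η : ℝ} (hη : 0 < η) (m : ι → Model Pol O)
    {Φ : Finset (Finset (ι × Pol))}
    (hΦ : (Φ : Set (Finset (ι × Pol))).PairwiseDisjoint id) {ν : ι × Pol → ℝ}
    (hν : ν ∈ distOn (Φ.biUnion id)) {ρ : Φ → ℝ} (hρ : ρ ∈ stdSimplex ℝ Φ)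
    (p : Pol → ℝ) :
    ∃ φ ∈ Φ, ∃ (ν' : ι × Pol → ℝ) (hν' : ν' ∈ distOn φ), AIR η m Φ ρ p ν ≤
      offset η p (fun π => comparatorValue m ν' - (mix m ν' hν'.1).value π)
        (fun π => klDiv ((mix m ν' hν'.1).law π) ((mix m ν hν.1).law π)) := by
  set v : Φ → ℝ := fun φ => ∑ ψ ∈ φ.1, ν ψ with hvdef
  have hv : v ∈ stdSimplex ℝ Φ := cellMass_mem_stdSimplex hΦ hν
  have hcond : ∀ φ, 0 < v φ → condDist ν φ.1 ∈ distOn φ.1 := fun φ h =>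
    condDist_mem_distOn hν.1.1 h
  set T : Pol → ℝ≥0∞ := fun π => ∑ ψ, ENNReal.ofReal (ν ψ) *
      ∫⁻ o, finKL (posterior m Φ ν π o) ρ ∂((m ψ.1).law π) with hT
  set K : Φ → Pol → ℝ≥0∞ := fun φ π => ∫⁻ o, relEnt (cellDensity m ν π φ.1 o)
        (v φ * cellDensity m ν π Finset.univ o) ∂(refMeasure m π) with hK
  -- For each cell the best multiple of the density of `M^ν` is the one with the mass of the cell,
  -- so the prior `v` is at least as good as `ρ`.
  have hKT : ∀ π, ∑ φ, K φ π ≤ T π := by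
    intro π
    rw [hT]
    dsimp only
    rw [sum_lintegral_finKL_posterior hΦ hν m hρ π]
    refine Finset.sum_le_sum fun φ _ => ?_
    refine lintegral_relEnt_mul_le _ (by fun_prop) (by fun_prop)
      (fun o => cellDensity_nonneg m hν.1.1 π _ o) (fun o => cellDensity_nonneg m hν.1.1 π _ o)
      (hv.1 φ) (hρ.1 φ) (lintegral_cellDensity m hν.1.1 π φ.1) ?_
    rw [lintegral_cellDensity m hν.1.1, hν.1.2, ENNReal.ofReal_one]
  obtain ⟨φ₀, hφ₀⟩ : ∃ φ, 0 < v φ := by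
    by_contra! hall
    have h1 : ∑ φ, v φ ≤ 0 := Finset.sum_nonpos fun φ _ => hall φ
    rw [hv.2] at h1
    linarith
  by_cases htop : ∑ π, ENNReal.ofReal (p π) * T π = ∞
  · refine ⟨φ₀.1, φ₀.2, _, hcond φ₀ hφ₀, ?_⟩
    rw [AIR, offset_eq_bot hη htop]
    exact bot_le
  set KK : Φ → ℝ≥0∞ := fun φ => ∑ π, ENNReal.ofReal (p π) * K φ π with hKK
  have hsum : ∑ φ, KK φ ≤ ∑ π, ENNReal.ofReal (p π) * T π := by
    rw [hKK, Finset.sum_comm]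
    refine Finset.sum_le_sum fun π _ => ?_
    rw [← Finset.mul_sum]
    gcongr
    exact hKT π
  have hKKtop : ∀ φ, KK φ ≠ ∞ := fun φ =>
    ENNReal.sum_ne_top.1 (ne_top_of_le_ne_top htop hsum) φ (Finset.mem_univ _)
  have hsumR : ∑ φ, (KK φ).toReal ≤ (∑ π, ENNReal.ofReal (p π) * T π).toReal := by
    rw [← ENNReal.toReal_sum fun φ _ => hKKtop φ]
    exact ENNReal.toReal_mono htop hsum
  -- If every cell were strictly worse, so would be their average with weights `v`; but that average
  -- is at least the AIR.
  by_contra! hcon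
  set G := ∑ π, p π * gain m ν π with hG
  set t := (∑ π, ENNReal.ofReal (p π) * T π).toReal with ht
  have hAIR : AIR η m Φ ρ p ν = ((G - t / η : ℝ) : EReal) := offset_eq_coe hη htop
  have hcell : ∀ φ, 0 < v φ →
      v φ * (∑ π, p π * gain m (condDist ν φ.1) π) - (KK φ).toReal / η < v φ * (G - t / η) := by
    intro φ hφ
    have h := hcon φ.1 φ.2 _ (hcond φ hφ)
    have hmul : ENNReal.ofReal (v φ) * ∑ π, ENNReal.ofReal (p π) *
        klDiv ((mix m _ (hcond φ hφ).1).law π) ((mix m ν hν.1).law π) = KK φ := by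
      rw [Finset.mul_sum]
      refine Finset.sum_congr rfl fun π _ => ?_
      rw [mul_left_comm, ofReal_mul_klDiv_mix_condDist]
    have hne : ∑ π, ENNReal.ofReal (p π) *
        klDiv ((mix m _ (hcond φ hφ).1).law π) ((mix m ν hν.1).law π) ≠ ∞ := by
      intro h0
      rw [h0, ENNReal.mul_top (by simpa using hφ)] at hmul
      exact hKKtop φ hmul.symm
    rw [hAIR, offset_eq_coe hη hne, EReal.coe_lt_coe_iff] at h
    simp only [← gain_eq] at h
    rw [← hmul, ENNReal.toReal_mul, ENNReal.toReal_ofReal hφ.le, mul_div_assoc, ← mul_sub]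
    exact mul_lt_mul_of_pos_left h hφ
  -- A cell of mass zero has no conditional distribution, but there the weak inequality is trivial;
  -- strictness comes from `φ₀`.
  have hcell' : ∀ φ, v φ * (∑ π, p π * gain m (condDist ν φ.1) π) - (KK φ).toReal / η ≤
      v φ * (G - t / η) := by
    intro φ
    rcases (hv.1 φ).eq_or_lt with h | h
    · rw [← h, zero_mul, zero_mul]
      have : 0 ≤ (KK φ).toReal / η := by positivity
      linarith
    · exact (hcell φ h).le
  have hlt := Finset.sum_lt_sum (fun φ _ => hcell' φ) ⟨φ₀, Finset.mem_univ _, hcell φ₀ hφ₀⟩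
  rw [← Finset.sum_mul, hv.2, one_mul, Finset.sum_sub_distrib, ← Finset.sum_div] at hlt
  have hgain : ∑ φ, v φ * (∑ π, p π * gain m (condDist ν φ.1) π) = G := by
    have h1 : ∀ φ, v φ * (∑ π, p π * gain m (condDist ν φ.1) π) =
        ∑ π, p π * ∑ ψ ∈ φ.1, ν ψ * ((m ψ.1).value ψ.2 - (m ψ.1).value π) := by
      intro φ
      rw [Finset.mul_sum]
      refine Finset.sum_congr rfl fun π _ => ?_
      rw [mul_left_comm, gain, mul_sum_condDist hν.1.1]
    rw [Finset.sum_congr rfl fun φ _ => h1 φ, Finset.sum_comm, hG]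
    refine Finset.sum_congr rfl fun π _ => ?_
    rw [← Finset.mul_sum, gain, sum_eq_sum_cells hΦ hν]
  rw [hgain] at hlt
  have : (∑ φ, (KK φ).toReal) / η ≤ t / η := by gcongr
  linarith

/-- The reference `M^ν` is chosen before `p`, so the infima over `p` can be compared for each `p`
separately. -/
theorem AIRValue_le_DECPhi {η : ℝ} (hη : 0 < η) (m : ι → Model Pol O)
    {Φ : Finset (Finset (ι × Pol))}
    (hΦ : (Φ : Set (Finset (ι × Pol))).PairwiseDisjoint id) :
    AIRValue η m Φ ≤ DECPhi η m Φ := by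
  refine iSup₂_le fun ρ hρ => iSup₂_le fun ν hν => ?_
  refine le_trans ?_ (le_iSup₂ (mix m ν hν.1)
    (mixture_mem_co _ hν.1 (fun ψ => m ψ.1) fun ψ _ => Set.mem_range_self ψ.1))
  refine iInf₂_mono fun p _ => ?_
  obtain ⟨φ, hφ, ν', hν', h⟩ := exists_cell_AIR_le_offset hη m hΦ hν hρ p
  refine h.trans ?_
  refine le_trans ?_ (le_iSup₂ φ hφ)
  exact le_iSup₂ (f := fun ν' (hν' : ν' ∈ distOn φ) =>
    offset η p (fun π => comparatorValue m ν' - (mix m ν' hν'.1).value π)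
        (fun π => klDiv ((mix m ν' hν'.1).law π) ((mix m ν hν.1).law π))) ν' hν'

omit [DecidableEq ι] [DecidableEq Pol] in
lemma comparatorGap_bddAbove [Nonempty Pol] (m : ι → Model Pol O)
    (Φ : Finset (Finset (ι × Pol))) :
    BddAbove {x | ∃ φ ∈ Φ, ∃ (ν : ι × Pol → ℝ) (hν : ν ∈ distOn φ),
      x = comparatorValue m ν - (mix m ν hν.1).value (mix m ν hν.1).opt} := by
  refine ⟨1, ?_⟩
  rintro x ⟨φ, _, ν, hν, rfl⟩
  rw [← gain_eq]
  exact gain_le_one m ν hν.1 _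

omit [DecidableEq ι] [DecidableEq Pol] in
lemma mix_mem_co (m : ι → Model Pol O) {S : Set (Model Pol O)} {φ : Finset (ι × Pol)}
    {ν : ι × Pol → ℝ} (hν : ν ∈ distOn φ) (hS : ∀ ψ ∈ φ, m ψ.1 ∈ S) : mix m ν hν.1 ∈ co S := by
  refine mixture_mem_co _ hν.1 _ fun ψ hψ => hS ψ ?_
  by_contra h
  exact hψ (hν.2 ψ h)

/-- The mixture of the good cell is itself a model of the convexified class, and `hgap` lets its
optimal policy replace the random comparator. -/
theorem AIRValue_le_DEC_convexification [Nonempty Pol] {η : ℝ} (hη : 0 < η) (m : ι → Model Pol O)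
    {Φ : Finset (Finset (ι × Pol))}
    (hΦ : (Φ : Set (Finset (ι × Pol))).PairwiseDisjoint id) (hgap : comparatorGap m Φ ≤ 0) :
    AIRValue η m Φ ≤ DEC η (convexification m Φ) := by
  refine iSup₂_le fun ρ hρ => iSup₂_le fun ν hν => ?_
  have hmem : mix m ν hν.1 ∈ co (convexification m Φ) := by
    refine mix_mem_co m hν fun ψ hψ => ?_
    obtain ⟨φ, hφ, hψφ⟩ := Finset.mem_biUnion.1 hψ
    exact Set.mem_biUnion hφ (subset_co _ ⟨ψ.1, ψ.2, hψφ, rfl⟩)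
  refine le_trans ?_ (le_iSup₂ (mix m ν hν.1) hmem)
  refine iInf₂_mono fun p hp => ?_
  obtain ⟨φ, hφ, ν', hν', h⟩ := exists_cell_AIR_le_offset hη m hΦ hν hρ p
  have hmem' : mix m ν' hν'.1 ∈ convexification m Φ :=
    Set.mem_biUnion hφ (mix_mem_co m hν' fun ψ hψ => ⟨ψ.1, ψ.2, hψ, rfl⟩)
  refine h.trans (le_trans ?_ (le_iSup₂ (mix m ν' hν'.1) hmem'))
  refine EReal.sub_le_sub (EReal.coe_le_coe_iff.2 (Finset.sum_le_sum fun π _ => ?_)) le_rfl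
  refine mul_le_mul_of_nonneg_left ?_ (hp.1 π)
  have := (le_csSup (comparatorGap_bddAbove m Φ) ⟨φ, hφ, ν', hν', rfl⟩).trans hgap
  linarith

end Upper

/-! ### Lower bound on the AIR value by separation -/

section Lower

/-- A convex set without a point all of whose coordinates exceed `c` lies below `c` on average,
for some weights. -/
lemma exists_weights_of_disjoint {κ : Type*} [Fintype κ] [Nonempty κ] {S : Set (κ → ℝ)}
    (hS : Convex ℝ S) {c : ℝ} (h : ∀ z ∈ S, ∃ k, z k ≤ c) :
    ∃ l ∈ stdSimplex ℝ κ, ∀ z ∈ S, ∑ k, l k * z k ≤ c := by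
  classical
  rcases S.eq_empty_or_nonempty with rfl | ⟨z₀, hz₀⟩
  · exact ⟨_, single_mem_stdSimplex ℝ (Classical.arbitrary κ), by simp⟩
  set U : Set (κ → ℝ) := Set.univ.pi fun _ => Set.Ioi c with hU
  have hUconv : Convex ℝ U := convex_pi fun _ _ => convex_Ioi c
  have hUopen : IsOpen U := isOpen_set_pi Set.finite_univ fun _ _ => isOpen_Ioi
  have hdisj : Disjoint U S := by
    rw [Set.disjoint_left]
    intro z hz hzS
    obtain ⟨k, hk⟩ := h z hzS
    exact absurd (hz k (Set.mem_univ k)) (not_lt.2 hk)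
  obtain ⟨f, u, hfU, hfS⟩ := geometric_hahn_banach_open hUconv hUopen hS hdisj
  -- The functional is below `u` on the upward closed orthant `U` and at least `u` on `S`, so its
  -- negative has nonnegative coefficients.
  set l : κ → ℝ := fun k => - f (Pi.single k 1) with hl
  have hf : ∀ z, f z = - ∑ k, l k * z k := by
    intro z
    have hz : z = ∑ k, z k • (Pi.single k 1 : κ → ℝ) := by
      ext j
      simp [Finset.sum_apply, Pi.single_apply]
    conv_lhs => rw [hz]
    rw [map_sum, ← Finset.sum_neg_distrib]
    refine Finset.sum_congr rfl fun k _ => ?_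
    rw [map_smul, smul_eq_mul, hl]
    ring
  have hl0 : ∀ k, 0 ≤ l k := by
    intro k
    by_contra! hk
    have key : ∀ r : ℝ, 0 ≤ r → f (fun _ => c + 1) + r * (- l k) < u := by
      intro r hr
      have := hfU ((fun _ => c + 1) + r • (Pi.single k 1 : κ → ℝ)) (fun j _ => by
        simp only [Pi.add_apply, Pi.smul_apply, smul_eq_mul, Set.mem_Ioi, Pi.single_apply]
        split_ifs <;> linarith)
      rwa [map_add, map_smul, smul_eq_mul, show f (Pi.single k 1) = - l k by simp [hl]] at this
    have h0 := key 0 le_rfl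
    -- This is the step along coordinate `k` at which `f` would reach `u` while still in `U`.
    have h1 := key ((u - f (fun _ => c + 1)) / (- l k)) (by
      apply div_nonneg <;> linarith)
    rw [div_mul_cancel₀ _ (by linarith)] at h1
    linarith
  have hc : ∀ δ > 0, - u < (c + δ) * ∑ k, l k := by
    intro δ hδ
    have := hfU (fun _ => c + δ) (fun j _ => by simp [hδ])
    rw [hf, ← Finset.sum_mul] at this
    linarith
  have hle : ∀ z ∈ S, ∑ k, l k * z k ≤ - u := by
    intro z hz
    have := hfS z hz
    rw [hf] at this
    linarith
  -- The zero functional is excluded because `S` has a point: it would give both `0 ≤ -u` and `-u <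
  -- 0`.
  have hLne : ∑ k, l k ≠ 0 := by
    intro h0
    have hz := hle z₀ hz₀
    have h1 := hc 1 one_pos
    rw [h0, mul_zero] at h1
    have hlk := (Finset.sum_eq_zero_iff_of_nonneg fun k _ => hl0 k).1 h0
    rw [Finset.sum_eq_zero fun k hk => by rw [hlk k hk, zero_mul]] at hz
    linarith
  have hL : 0 < ∑ k, l k :=
    lt_of_le_of_ne (Finset.sum_nonneg fun k _ => hl0 k) hLne.symm
  refine ⟨fun k => l k / ∑ j, l j, ⟨fun k => div_nonneg (hl0 k) hL.le, ?_⟩, fun z hz => ?_⟩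
  · rw [← Finset.sum_div, div_self hLne]
  · have h1 : ∑ k, l k / (∑ j, l j) * z k = (∑ k, l k * z k) / ∑ j, l j := by
      rw [Finset.sum_div]
      exact Finset.sum_congr rfl fun k _ => by ring
    rw [h1, div_le_iff₀ hL]
    refine (hle z hz).trans ?_
    refine le_of_forall_pos_le_add fun ε hε => ?_
    have h2 := (hc (ε / ∑ j, l j) (by positivity)).le
    rw [add_mul, div_mul_cancel₀ _ hLne] at h2
    exact h2

variable {ι Pol O : Type*} [Fintype ι] [Fintype Pol] [MeasurableSpace O]

/-- The divergence of the cells under `ν` from the reference density `n`, on average. -/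
noncomputable def cellDiv (m : ι → Model Pol O) (Φ : Finset (Finset (ι × Pol)))
    (n : Pol → O → ℝ) (ν : ι × Pol → ℝ) (π : Pol) : ℝ≥0∞ :=
  ∑ φ : Φ, ∫⁻ o, relEnt (cellDensity m ν π φ.1 o) ((∑ ψ ∈ φ.1, ν ψ) * n π o) ∂(refMeasure m π)

omit [Fintype Pol] in
-- Both arguments of `relEnt` are linear in `ν`, since the reference is scaled by the cell mass
-- instead of conditioning on the cell; joint convexity then applies.
lemma cellDiv_convexComb_le (m : ι → Model Pol O) (Φ : Finset (Finset (ι × Pol)))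
    {n : Pol → O → ℝ} (hn : ∀ π, Measurable (n π)) (hn0 : ∀ π o, 0 ≤ n π o) {ν ν' : ι × Pol → ℝ}
    (hν : ∀ ψ, 0 ≤ ν ψ) (hν' : ∀ ψ, 0 ≤ ν' ψ) {a b : ℝ} (ha : 0 ≤ a) (hb : 0 ≤ b) (π : Pol) :
    cellDiv m Φ n (a • ν + b • ν') π ≤
      ENNReal.ofReal a * cellDiv m Φ n ν π + ENNReal.ofReal b * cellDiv m Φ n ν' π := by
  rw [cellDiv, cellDiv, cellDiv, Finset.mul_sum, Finset.mul_sum, ← Finset.sum_add_distrib]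
  refine Finset.sum_le_sum fun φ _ => ?_
  have hm : ∀ w : ι × Pol → ℝ, Measurable fun o =>
      relEnt (cellDensity m w π φ.1 o) ((∑ ψ ∈ φ.1, w ψ) * n π o) := fun w =>
    measurable_relEnt (by fun_prop) ((hn π).const_mul _)
  rw [← lintegral_const_mul _ (hm ν), ← lintegral_const_mul _ (hm ν'),
    ← lintegral_add_left ((hm ν).const_mul _)]
  refine lintegral_mono fun o => ?_
  dsimp only
  rw [← relEnt_mul ha, ← relEnt_mul hb]
  have h1 : cellDensity m (a • ν + b • ν') π φ.1 o =
      a * cellDensity m ν π φ.1 o + b * cellDensity m ν' π φ.1 o := by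
    simp only [cellDensity, Finset.mul_sum, ← Finset.sum_add_distrib, Pi.add_apply, Pi.smul_apply,
      smul_eq_mul]
    exact Finset.sum_congr rfl fun ψ _ => by ring
  have h2 : (∑ ψ ∈ φ.1, (a • ν + b • ν') ψ) * n π o =
      a * ((∑ ψ ∈ φ.1, ν ψ) * n π o) + b * ((∑ ψ ∈ φ.1, ν' ψ) * n π o) := by
    simp only [Pi.add_apply, Pi.smul_apply, smul_eq_mul, Finset.sum_add_distrib, ← Finset.mul_sum]
    ring
  rw [h1, h2]
  have h3 := Finset.sum_nonneg fun ψ (_ : ψ ∈ φ.1) => hν ψ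
  have h4 := Finset.sum_nonneg fun ψ (_ : ψ ∈ φ.1) => hν' ψ
  exact relEnt_add_le (mul_nonneg ha (cellDensity_nonneg m hν _ _ _))
    (mul_nonneg ha (mul_nonneg h3 (hn0 π o))) (mul_nonneg hb (cellDensity_nonneg m hν' _ _ _))
    (mul_nonneg hb (mul_nonneg h4 (hn0 π o)))

/-- On a single cell, the divergence is that of the mixture. -/
lemma cellDiv_of_distOn (m : ι → Model Pol O) {Φ : Finset (Finset (ι × Pol))}
    (hΦ : (Φ : Set (Finset (ι × Pol))).PairwiseDisjoint id)
    {n : Pol → O → ℝ} (hn : ∀ π, Measurable (n π)) (hn0 : ∀ π o, 0 ≤ n π o) {N : Model Pol O}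
    (hN : ∀ π, N.law π = (refMeasure m π).withDensity fun o => ENNReal.ofReal (n π o))
    {φ : Finset (ι × Pol)} (hφ : φ ∈ Φ) {ν : ι × Pol → ℝ} (hν : ν ∈ distOn φ) (π : Pol) :
    cellDiv m Φ n ν π = klDiv ((mix m ν hν.1).law π) (N.law π) := by
  have h1 := (mix m _ hν.1).isProb π
  have h2 := N.isProb π
  rw [mix_law] at h1
  rw [hN] at h2
  rw [hN, mix_law, klDiv_withDensity _ (by fun_prop) (hn π)
    (fun o => cellDensity_nonneg m hν.1.1 π _ o) (hn0 π), cellDiv,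
    Finset.sum_eq_single (⟨φ, hφ⟩ : Φ)]
  · refine lintegral_congr fun o => ?_
    have h3 : ∑ ψ ∈ φ, ν ψ = 1 := by
      have := sum_eq_sum_of_distOn hν fun _ => 1
      simp only [mul_one] at this
      rw [← this, hν.1.2]
    dsimp only
    rw [h3, one_mul]
    congr 1
    exact (sum_eq_sum_of_distOn hν _).symm
  · intro φ' _ hne
    have hzero : ∀ ψ ∈ φ'.1, ν ψ = 0 := by
      intro ψ hψ
      refine hν.2 ψ fun hψ' => ?_
      have hd : Disjoint φ'.1 φ := hΦ φ'.2 hφ fun h => hne (Subtype.ext h)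
      exact (Finset.disjoint_left.1 hd hψ) hψ'
    have hz : ∀ o, cellDensity m ν π φ'.1 o = 0 := fun o =>
      Finset.sum_eq_zero fun ψ hψ => by rw [hzero ψ hψ, zero_mul]
    simp [hz, Finset.sum_eq_zero hzero]
  · intro h
    exact absurd (Finset.mem_univ _) h

/-- With the prior `ν` over cells, the expected divergence of the posterior is at most `cellDiv`. -/
lemma sum_lintegral_finKL_posterior_le [DecidableEq ι] [DecidableEq Pol]
    {Φ : Finset (Finset (ι × Pol))}
    (hΦ : (Φ : Set (Finset (ι × Pol))).PairwiseDisjoint id) {ν : ι × Pol → ℝ}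
    (hν : ν ∈ distOn (Φ.biUnion id)) (m : ι → Model Pol O) {n : Pol → O → ℝ}
    (hn : ∀ π, Measurable (n π)) (hn0 : ∀ π o, 0 ≤ n π o) (π : Pol) :
    ∑ ψ, ENNReal.ofReal (ν ψ) * ∫⁻ o, finKL (posterior m Φ ν π o)
      (fun φ : Φ => ∑ ψ ∈ φ.1, ν ψ) ∂((m ψ.1).law π) ≤ cellDiv m Φ n ν π := by
  have hv := cellMass_mem_stdSimplex hΦ hν
  rw [sum_lintegral_finKL_posterior hΦ hν m hv, cellDiv,
    ← lintegral_finsetSum _ fun φ _ => measurable_relEnt (by fun_prop) (by fun_prop),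
    ← lintegral_finsetSum _ fun φ _ => measurable_relEnt (by fun_prop) ((hn π).const_mul _)]
  -- At each `o`, the value of `n` that minimizes the sum over cells is the total density of `ν`.
  refine lintegral_mono fun o => ?_
  rw [cellDensity_univ hΦ hν]
  exact sum_relEnt_mul_sum_le (fun φ : Φ => cellDensity m ν π φ.1 o) _
    (fun φ => cellDensity_nonneg m hν.1.1 π _ o) hv (hn0 π o)

lemma gain_convexComb (m : ι → Model Pol O) (ν ν' : ι × Pol → ℝ) (a b : ℝ) (π : Pol) :
    gain m (a • ν + b • ν') π = a * gain m ν π + b * gain m ν' π := by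
  simp only [gain, Finset.mul_sum, ← Finset.sum_add_distrib, Pi.add_apply, Pi.smul_apply,
    smul_eq_mul]
  exact Finset.sum_congr rfl fun ψ _ => by ring

lemma convex_distOn {κ : Type*} [Fintype κ] (S : Finset κ) : Convex ℝ (distOn S) := by
  intro ν hν ν' hν' a b ha hb hab
  refine ⟨convex_stdSimplex ℝ κ hν.1 hν'.1 ha hb hab, fun x hx => ?_⟩
  simp [hν.2 x hx, hν'.2 x hx]

/-- The payoff vectors that distributions on the union of the cells can guarantee against the
reference density `n`. -/
def payoffs [DecidableEq ι] [DecidableEq Pol] (η : ℝ) (m : ι → Model Pol O)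
    (Φ : Finset (Finset (ι × Pol))) (n : Pol → O → ℝ) : Set (Pol → ℝ) :=
  {z | ∃ ν ∈ distOn (Φ.biUnion id), ∀ π, z π ≤ gain m ν π ∧
    cellDiv m Φ n ν π ≤ ENNReal.ofReal (η * (gain m ν π - z π))}

/-- The set lies under concave functions of `ν`: the gain is linear and the divergence convex. The
separate condition `z π ≤ gain m ν π` is needed because `ENNReal.ofReal` truncates negative numbers.
-/
lemma convex_payoffs [DecidableEq ι] [DecidableEq Pol] {η : ℝ} (hη : 0 < η) (m : ι → Model Pol O)
    (Φ : Finset (Finset (ι × Pol))) {n : Pol → O → ℝ}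
    (hn : ∀ π, Measurable (n π)) (hn0 : ∀ π o, 0 ≤ n π o) : Convex ℝ (payoffs η m Φ n) := by
  rintro z ⟨ν, hν, hz⟩ z' ⟨ν', hν', hz'⟩ a b ha hb hab
  refine ⟨a • ν + b • ν', convex_distOn _ hν hν' ha hb hab, fun π => ?_⟩
  obtain ⟨h1, h2⟩ := hz π
  obtain ⟨h1', h2'⟩ := hz' π
  simp only [Pi.add_apply, Pi.smul_apply, smul_eq_mul]
  rw [gain_convexComb]
  constructor
  · gcongr
  · refine (cellDiv_convexComb_le m Φ hn hn0 hν.1.1 hν'.1.1 ha hb π).trans ?_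
    have e1 := mul_nonneg hη.le (sub_nonneg.2 h1)
    have e2 := mul_nonneg hη.le (sub_nonneg.2 h1')
    calc _ ≤ ENNReal.ofReal a * ENNReal.ofReal (η * (gain m ν π - z π)) +
          ENNReal.ofReal b * ENNReal.ofReal (η * (gain m ν' π - z' π)) := by gcongr
      _ = _ := by
        rw [← ENNReal.ofReal_mul ha, ← ENNReal.ofReal_mul hb,
          ← ENNReal.ofReal_add (mul_nonneg ha e1) (mul_nonneg hb e2)]
        congr 1
        ring

/-- Otherwise the witness `ν`, with its own cell masses as prior, would keep AIR at least `c`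
against every `p`. -/
lemma exists_le_of_mem_payoffs [DecidableEq ι] [DecidableEq Pol] {η : ℝ} (hη : 0 < η)
    (m : ι → Model Pol O) {Φ : Finset (Finset (ι × Pol))}
    (hΦ : (Φ : Set (Finset (ι × Pol))).PairwiseDisjoint id) {n : Pol → O → ℝ}
    (hn : ∀ π, Measurable (n π)) (hn0 : ∀ π o, 0 ≤ n π o) {c : ℝ} (hc : AIRValue η m Φ < c)
    {z : Pol → ℝ} (hz : z ∈ payoffs η m Φ n) : ∃ π, z π ≤ c := by
  by_contra! hall
  obtain ⟨ν, hν, h⟩ := hz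
  refine absurd hc (not_lt.2 ?_)
  refine le_trans ?_ (le_iSup₂ _ (cellMass_mem_stdSimplex hΦ hν))
  refine le_trans ?_ (le_iSup₂ ν hν)
  refine le_iInf₂ fun p hp => ?_
  refine le_trans (EReal.coe_le_coe_iff.2 ?_) (le_offset hη hp.1 (fun π => (h π).1) fun π =>
    (sum_lintegral_finKL_posterior_le hΦ hν m hn hn0 π).trans (h π).2)
  calc c = ∑ π, p π * c := by rw [← Finset.sum_mul, hp.2, one_mul]
    _ ≤ ∑ π, p π * z π :=
      Finset.sum_le_sum fun π _ => mul_le_mul_of_nonneg_left (hall π).le (hp.1 π)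

omit [Fintype Pol] in
/-- Every finite mixture of the models has a density with respect to the reference measure. -/
lemma exists_density_of_mem_co (m : ι → Model Pol O) {N : Model Pol O}
    (hN : N ∈ co (Set.range m)) : ∃ n : Pol → O → ℝ, (∀ π, Measurable (n π)) ∧
      (∀ π o, 0 ≤ n π o) ∧
      ∀ π, N.law π = (refMeasure m π).withDensity fun o => ENNReal.ofReal (n π o) := by
  obtain ⟨k, w, hw, m', hm', rfl⟩ := hN
  choose i hi using hm'
  obtain rfl : (fun j => m (i j)) = m' := funext hi
  exact ⟨fun π o => ∑ j, w j * density m (i j) π o, fun π => by fun_prop,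
    fun π o => Finset.sum_nonneg fun j _ => mul_nonneg (hw.1 j) (density_nonneg _ _ _ _),
    fun π => sum_smul_law m w hw.1 i π⟩

/-- This is the minimax direction: separation turns "for every `ν` some policy is good" into one `p`
that is good against all `ν`. -/
theorem DECPhi_le_AIRValue [DecidableEq ι] [DecidableEq Pol] [Nonempty Pol] {η : ℝ} (hη : 0 < η)
    (m : ι → Model Pol O) {Φ : Finset (Finset (ι × Pol))}
    (hΦ : (Φ : Set (Finset (ι × Pol))).PairwiseDisjoint id) :
    DECPhi η m Φ ≤ AIRValue η m Φ := by
  refine iSup₂_le fun N hN => ?_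
  obtain ⟨n, hn, hn0, hNn⟩ := exists_density_of_mem_co m hN
  refine EReal.le_of_forall_lt_iff_le.1 fun d hd => ?_
  obtain ⟨c, hc, hcd⟩ := EReal.lt_iff_exists_real_btwn.1 hd
  rw [EReal.coe_lt_coe_iff] at hcd
  obtain ⟨l, hl, hlS⟩ := exists_weights_of_disjoint (convex_payoffs hη m Φ hn hn0)
    fun z hz => exists_le_of_mem_payoffs hη m hΦ hn hn0 hc hz
  -- The gap between `c` and `d` pays for exploration with probability `ε`, where payoffs are at
  -- most `1`.
  obtain ⟨ε, hε0, hε1, hε⟩ : ∃ ε : ℝ, 0 < ε ∧ ε ≤ 1 ∧ (1 - ε) * c + ε ≤ d := by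
    have hden : 0 < |1 - c| + 1 := by positivity
    refine ⟨min 1 ((d - c) / (|1 - c| + 1)), lt_min one_pos (div_pos (by linarith) hden),
      min_le_left _ _, ?_⟩
    set ε := min 1 ((d - c) / (|1 - c| + 1))
    have h0 : 0 < ε := lt_min one_pos (div_pos (by linarith) hden)
    have h1 : ε * (|1 - c| + 1) ≤ d - c := (le_div_iff₀ hden).1 (min_le_right _ _)
    have h2 : ε * (1 - c) ≤ ε * (|1 - c| + 1) :=
      mul_le_mul_of_nonneg_left (by linarith [le_abs_self (1 - c)]) h0.le
    linarith
  set unif : Pol → ℝ := fun _ => (Fintype.card Pol : ℝ)⁻¹ with hunif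
  have hcard : (0 : ℝ) < Fintype.card Pol := by exact_mod_cast Fintype.card_pos
  have hunif_mem : unif ∈ stdSimplex ℝ Pol := by
    refine ⟨fun _ => by positivity, ?_⟩
    simp [hunif, hcard.ne']
  set p : Pol → ℝ := (1 - ε) • l + ε • unif with hpdef
  have hp : p ∈ stdSimplex ℝ Pol :=
    convex_stdSimplex ℝ Pol hl hunif_mem (by linarith) hε0.le (by ring)
  have hp0 : ∀ π, 0 < p π := by
    intro π
    have h1 : 0 ≤ (1 - ε) * l π := mul_nonneg (by linarith) (hl.1 π)
    have h2 : 0 < ε * (Fintype.card Pol : ℝ)⁻¹ := by positivity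
    simp only [hpdef, hunif, Pi.add_apply, Pi.smul_apply, smul_eq_mul]
    linarith
  refine (iInf₂_le p hp).trans (iSup₂_le fun φ hφ => iSup₂_le fun ν hν => ?_)
  by_cases htop : ∑ π, ENNReal.ofReal (p π) * klDiv ((mix m ν hν.1).law π) (N.law π) = ∞
  · rw [offset_eq_bot hη htop]
    exact bot_le
  have hne : ∀ π, klDiv ((mix m ν hν.1).law π) (N.law π) ≠ ∞ := by
    intro π h
    refine htop (ENNReal.sum_eq_top.2 ⟨π, Finset.mem_univ _, ?_⟩)
    rw [h, ENNReal.mul_top (by simpa using hp0 π)]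
  rw [offset_eq_coe hη htop, EReal.coe_le_coe_iff]
  simp only [← gain_eq]
  set z : Pol → ℝ := fun π => gain m ν π -
    (klDiv ((mix m ν hν.1).law π) (N.law π)).toReal / η with hz
  have hzle : ∀ π, z π ≤ gain m ν π := by
    intro π
    have : 0 ≤ (klDiv ((mix m ν hν.1).law π) (N.law π)).toReal / η := by positivity
    simp only [hz]
    linarith
  have hzmem : z ∈ payoffs η m Φ n := by
    refine ⟨ν, ⟨hν.1, fun ψ hψ => hν.2 ψ fun h => hψ ?_⟩, fun π => ⟨hzle π, ?_⟩⟩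
    · exact Finset.mem_biUnion.2 ⟨φ, hφ, h⟩
    · rw [cellDiv_of_distOn m hΦ hn hn0 hNn hφ hν]
      simp only [hz, sub_sub_cancel]
      rw [mul_div_cancel₀ _ hη.ne', ENNReal.ofReal_toReal (hne π)]
  have hsum : ∑ π, p π * gain m ν π - (∑ π, ENNReal.ofReal (p π) *
      klDiv ((mix m ν hν.1).law π) (N.law π)).toReal / η = ∑ π, p π * z π := by
    rw [ENNReal.toReal_sum fun π _ => ENNReal.mul_ne_top ENNReal.ofReal_ne_top (hne π),
      Finset.sum_div, ← Finset.sum_sub_distrib]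
    refine Finset.sum_congr rfl fun π _ => ?_
    rw [ENNReal.toReal_mul, ENNReal.toReal_ofReal (hp0 π).le]
    simp only [hz]
    ring
  rw [hsum]
  have h1 := hlS z hzmem
  have h2 : ∑ π, unif π * z π ≤ 1 := by
    rw [← hunif_mem.2]
    exact Finset.sum_le_sum fun π _ => mul_le_of_le_one_right (hunif_mem.1 π)
      ((hzle π).trans (gain_le_one m ν hν.1 π))
  have h3 : ∑ π, p π * z π = (1 - ε) * ∑ π, l π * z π + ε * ∑ π, unif π * z π := by
    rw [Finset.mul_sum, Finset.mul_sum, ← Finset.sum_add_distrib]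
    refine Finset.sum_congr rfl fun π _ => ?_
    simp only [hpdef, Pi.add_apply, Pi.smul_apply, smul_eq_mul]
    ring
  have h4 := mul_le_mul_of_nonneg_left h1 (sub_nonneg.2 hε1)
  have h5 := mul_le_mul_of_nonneg_left h2 hε0.le
  rw [h3]
  linarith

end Lower

/-! ### The comparator gap and its attainment -/

section Gap

variable {ι Pol O : Type*} [Fintype ι] [Fintype Pol] [MeasurableSpace O]

/-- With a single comparator the expected comparator value is the value of that policy under the
mixture, hence at most the optimum. -/
lemma comparatorGap_nonpos_of_fixedComparator [Nonempty Pol] (m : ι → Model Pol O)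
    {Φ : Finset (Finset (ι × Pol))} (h : FixedComparator Φ) : comparatorGap m Φ ≤ 0 := by
  refine Real.sSup_le ?_ le_rfl
  rintro x ⟨φ, hφ, ν, hν, rfl⟩
  obtain ⟨ψ₀, hψ₀⟩ : ∃ ψ, ν ψ ≠ 0 := by
    by_contra! hall
    have := hν.1.2
    simp [hall] at this
  have hmem : ∀ ψ, ν ψ ≠ 0 → ψ ∈ φ := fun ψ hψ => by
    by_contra hn
    exact hψ (hν.2 ψ hn)
  have hval : comparatorValue m ν = (mix m ν hν.1).value ψ₀.2 := by
    refine Finset.sum_congr rfl fun ψ _ => ?_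
    by_cases hψ : ν ψ = 0
    · rw [hψ, zero_mul, zero_mul]
    · rw [h φ hφ ψ (hmem ψ hψ) ψ₀ (hmem ψ₀ hψ₀)]
  rw [hval]
  exact sub_nonpos.2 (Model.value_le_opt _ _)

/-- If the prior is concentrated on the cell that supports `ν`, nothing is learned about the
cell. -/
lemma finKL_posterior_single [DecidableEq ι] [DecidableEq Pol] (m : ι → Model Pol O)
    {Φ : Finset (Finset (ι × Pol))}
    (hΦ : (Φ : Set (Finset (ι × Pol))).PairwiseDisjoint id) (φ : Φ) {ν : ι × Pol → ℝ}
    (hν : ν ∈ distOn φ.1) (π : Pol) (o : O) :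
    finKL (posterior m Φ ν π o) (Pi.single φ 1) = 0 := by
  have hzero : ∀ φ' : Φ, φ' ≠ φ → ∑ ψ ∈ φ'.1, ν ψ * density m ψ.1 π o = 0 := by
    intro φ' hne
    refine Finset.sum_eq_zero fun ψ hψ => ?_
    rw [hν.2 ψ, zero_mul]
    intro hψ'
    have hd : Disjoint φ'.1 φ.1 := hΦ φ'.2 φ.2 fun h => hne (Subtype.ext h)
    exact (Finset.disjoint_left.1 hd hψ) hψ'
  have hpost : ∀ φ' : Φ, φ' ≠ φ → posterior m Φ ν π o φ' = 0 := fun φ' hne => by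
    rw [posterior, hzero φ' hne, zero_div]
  rw [finKL, if_neg]
  · rw [Finset.sum_eq_single φ (fun φ' _ hne => by rw [hpost φ' hne, zero_mul])
      (fun h => absurd (Finset.mem_univ _) h)]
    -- The value `0` occurs where the observation has density zero and the quotient is `0 / 0`; the
    -- summand vanishes in both cases.
    have hself : posterior m Φ ν π o φ = 0 ∨ posterior m Φ ν π o φ = 1 := by
      have hden : ∑ φ' ∈ Φ, ∑ ψ ∈ φ', ν ψ * density m ψ.1 π o =
          ∑ ψ ∈ φ.1, ν ψ * density m ψ.1 π o := by
        rw [← Finset.sum_coe_sort Φ (fun φ' => ∑ ψ ∈ φ', ν ψ * density m ψ.1 π o),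
          Finset.sum_eq_single φ (fun φ' _ hne => hzero φ' hne)
            (fun h => absurd (Finset.mem_univ _) h)]
      rw [posterior, hden]
      by_cases h0 : ∑ ψ ∈ φ.1, ν ψ * density m ψ.1 π o = 0
      · exact Or.inl (by rw [h0, zero_div])
      · exact Or.inr (div_self h0)
    rcases hself with h | h <;> simp [h]
  · rintro ⟨φ', h1, h2⟩
    by_cases hne : φ' = φ
    · subst hne
      simp at h1
    · exact h2 (hpost φ' hne)

/-- The prior is a point mass on `φ`, so the information term is zero for every `η` and only the
regret remains. -/
theorem comparatorValue_sub_le_AIRValue [DecidableEq ι] [DecidableEq Pol] [Nonempty Pol] {η : ℝ}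
    (hη : 0 < η) (m : ι → Model Pol O) {Φ : Finset (Finset (ι × Pol))}
    (hΦ : (Φ : Set (Finset (ι × Pol))).PairwiseDisjoint id) {φ : Finset (ι × Pol)} (hφ : φ ∈ Φ)
    {ν : ι × Pol → ℝ} (hν : ν ∈ distOn φ) :
    ((comparatorValue m ν - (mix m ν hν.1).value (mix m ν hν.1).opt : ℝ) : EReal) ≤
      AIRValue η m Φ := by
  have hν' : ν ∈ distOn (Φ.biUnion id) :=
    ⟨hν.1, fun ψ hψ => hν.2 ψ fun h => hψ (Finset.mem_biUnion.2 ⟨φ, hφ, h⟩)⟩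
  refine le_trans ?_ (le_iSup₂ _ (single_mem_stdSimplex ℝ (⟨φ, hφ⟩ : Φ)))
  refine le_trans ?_ (le_iSup₂ ν hν')
  refine le_iInf₂ fun p hp => ?_
  refine le_trans (EReal.coe_le_coe_iff.2 ?_) (le_offset hη hp.1 (fun π => le_rfl) fun π => ?_)
  · set c := comparatorValue m ν - (mix m ν hν.1).value (mix m ν hν.1).opt with hc
    calc c = ∑ π, p π * c := by rw [← Finset.sum_mul, hp.2, one_mul]
      _ ≤ ∑ π, p π * gain m ν π := by
        refine Finset.sum_le_sum fun π _ => mul_le_mul_of_nonneg_left ?_ (hp.1 π)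
        rw [gain_eq m ν hν.1, hc]
        linarith [Model.value_le_opt (mix m ν hν.1) π]
  · simp [finKL_posterior_single m hΦ ⟨φ, hφ⟩ hν]

/-- The supremum in the definition of `comparatorGap` is attained. -/
theorem exists_eq_comparatorGap [Nonempty Pol] (m : ι → Model Pol O)
    {Φ : Finset (Finset (ι × Pol))} (h : 0 < comparatorGap m Φ) :
    ∃ φ ∈ Φ, ∃ (ν : ι × Pol → ℝ) (hν : ν ∈ distOn φ),
      comparatorGap m Φ = comparatorValue m ν - (mix m ν hν.1).value (mix m ν hν.1).opt := by
  -- As a minimum of linear functions over policies, `G` is visibly continuous, although the choice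
  -- of optimal policy is not.
  set G : (ι × Pol → ℝ) → ℝ := fun ν =>
    Finset.univ.inf' Finset.univ_nonempty fun π => gain m ν π with hG
  have hGcont : Continuous G := by
    refine Continuous.finset_inf'_apply _ fun π _ => ?_
    unfold gain
    fun_prop
  have hGeq : ∀ ν (hν : ν ∈ stdSimplex ℝ (ι × Pol)),
      comparatorValue m ν - (mix m ν hν).value (mix m ν hν).opt = G ν := by
    intro ν hν
    refine le_antisymm (Finset.le_inf' _ _ fun π _ => ?_) ?_
    · rw [gain_eq m ν hν]
      linarith [Model.value_le_opt (mix m ν hν) π]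
    · rw [← gain_eq]
      exact Finset.inf'_le _ (Finset.mem_univ _)
  have hset : {x | ∃ φ ∈ Φ, ∃ (ν : ι × Pol → ℝ) (hν : ν ∈ distOn φ),
      x = comparatorValue m ν - (mix m ν hν.1).value (mix m ν hν.1).opt} =
      ⋃ φ ∈ Φ, G '' distOn φ := by
    ext x
    simp only [Set.mem_ofPred_eq, Set.mem_iUnion, Set.mem_image, exists_prop]
    refine exists_congr fun φ => and_congr_right fun _ => ?_
    constructor
    · rintro ⟨ν, hν, rfl⟩
      exact ⟨ν, hν, (hGeq ν hν.1).symm⟩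
    · rintro ⟨ν, hν, rfl⟩
      exact ⟨ν, hν, (hGeq ν hν.1).symm⟩
  have hcomp : IsCompact (⋃ φ ∈ Φ, G '' distOn φ) := by
    refine Φ.isCompact_biUnion fun φ _ => IsCompact.image ?_ hGcont
    have hcl : IsClosed {ν : ι × Pol → ℝ | ∀ x, x ∉ φ → ν x = 0} := by
      simp only [Set.ofPred_forall]
      exact isClosed_iInter fun x => isClosed_iInter fun _ =>
        isClosed_eq (continuous_apply x) continuous_const
    exact (isCompact_stdSimplex ℝ (ι × Pol)).inter_right hcl
  -- The supremum of the empty set of reals is `0`, so positivity of the gap gives nonemptiness.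
  have hne : (⋃ φ ∈ Φ, G '' distOn φ).Nonempty := by
    rw [Set.nonempty_iff_ne_empty]
    intro h0
    rw [comparatorGap, hset, h0, Real.sSup_empty] at h
    exact lt_irrefl _ h
  have hmem := hcomp.sSup_mem hne
  rw [← hset] at hmem
  exact hmem

end Gap

/-! ### Linear regret against independent draws -/

section Regret

/-- The instantaneous regret in a round. -/
def roundRegret {ι Pol O : Type*} [MeasurableSpace O] (m : ι → Model Pol O) (x : Round ι Pol O) : ℝ :=
  (m x.1.1.1).value x.1.1.2 - (m x.1.1.1).value x.1.2

lemma abs_roundRegret_le {ι Pol O : Type*} [MeasurableSpace O] (m : ι → Model Pol O) (x : Round ι Pol O) : |roundRegret m x| ≤ 1 := by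
  have h1 := (m x.1.1.1).value_mem x.1.1.2
  have h2 := (m x.1.1.1).value_mem x.1.2
  rw [roundRegret, abs_le]
  exact ⟨by linarith [h1.1, h2.2], by linarith [h1.2, h2.1]⟩

variable {ι Pol O : Type*} [Fintype ι] [Fintype Pol]
  [MeasurableSpace ι] [MeasurableSingletonClass ι] [MeasurableSpace Pol]
  [MeasurableSingletonClass Pol] [MeasurableSpace O]

/-- The measure with the weights `ν` on a finite type. -/
noncomputable def weightMeasure {κ : Type*} [Fintype κ] [MeasurableSpace κ] (ν : κ → ℝ) :
    Measure κ :=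
  ∑ k, ENNReal.ofReal (ν k) • Measure.dirac k

lemma isProbabilityMeasure_weightMeasure {κ : Type*} [Fintype κ] [MeasurableSpace κ] {ν : κ → ℝ}
    (hν : ν ∈ stdSimplex ℝ κ) : IsProbabilityMeasure (weightMeasure ν) := by
  constructor
  simp only [weightMeasure, Measure.coe_finsetSum, Finset.sum_apply, Measure.smul_apply,
    measure_univ, smul_eq_mul, mul_one]
  rw [← ENNReal.ofReal_sum_of_nonneg (fun k _ => hν.1 k), hν.2, ENNReal.ofReal_one]

lemma integral_weightMeasure {κ : Type*} [Fintype κ] [MeasurableSpace κ]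
    [MeasurableSingletonClass κ] {ν : κ → ℝ} (hν : ∀ k, 0 ≤ ν k) (f : κ → ℝ) :
    ∫ k, f k ∂(weightMeasure ν) = ∑ k, ν k * f k := by
  rw [weightMeasure, integral_finsetSum_measure]
  · refine Finset.sum_congr rfl fun k _ => ?_
    rw [integral_smul_measure, integral_dirac, ENNReal.toReal_ofReal (hν k), smul_eq_mul]
  · intro k _
    exact (integrable_dirac (by simp)).smul_measure ENNReal.ofReal_ne_top

/-- The environment that draws its pairs independently from a distribution on a cell. -/
noncomputable def iidEnvironment (O : Type*) [MeasurableSpace O] {Φ : Finset (Finset (ι × Pol))}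
    {φ : Finset (ι × Pol)} (hφ : φ ∈ Φ) {ν : ι × Pol → ℝ} (hν : ν ∈ distOn φ) :
    Environment O Φ where
  cell := φ
  cell_mem := hφ
  select _ := Kernel.const _ (weightMeasure ν)
  markov _ := by
    have := isProbabilityMeasure_weightMeasure hν.1
    infer_instance
  select_mem _ h := by
    rw [Kernel.const_apply, ae_iff, weightMeasure, Measure.coe_finsetSum, Finset.sum_apply]
    refine Finset.sum_eq_zero fun ψ _ => ?_
    by_cases hψ : ψ ∈ φ
    · simp [hψ]
    · simp [hν.2 ψ hψ]

@[fun_prop]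
lemma measurable_roundRegret (m : ι → Model Pol O) : Measurable (roundRegret m) :=
  (measurable_of_countable fun x : (ι × Pol) × Pol =>
    (m x.1.1).value x.1.2 - (m x.1.1).value x.2).comp measurable_fst

lemma integrable_roundRegret (m : ι → Model Pol O) {Ω : Type*} [MeasurableSpace Ω]
    (P : Measure Ω) [IsFiniteMeasure P] {f : Ω → Round ι Pol O} (hf : Measurable f) :
    Integrable (fun ω => roundRegret m (f ω)) P :=
  Integrable.of_bound ((measurable_roundRegret m).comp hf).aestronglyMeasurable 1
    (Filter.Eventually.of_forall fun ω => abs_roundRegret_le m (f ω))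

instance (m : ι → Model Pol O) : IsMarkovKernel (obsKernel m) :=
  ⟨fun x => (m x.1.1).isProb x.2⟩

instance (m : ι → Model Pol O) {Φ : Finset (Finset (ι × Pol))} (E : Environment O Φ)
    (L : Learner Pol O) (t : ℕ) : IsMarkovKernel (stepKernel m E L t) := by
  have := E.markov t
  have := L.markov t
  unfold stepKernel
  infer_instance

lemma measurable_snoc {X : Type*} [MeasurableSpace X] (t : ℕ) :
    Measurable fun x : (Fin t → X) × X => (Fin.snoc x.1 x.2 : Fin (t + 1) → X) := by
  refine measurable_pi_iff.2 fun s => ?_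
  induction s using Fin.lastCases with
  | last => simpa using measurable_snd
  | cast s =>
    simp only [Fin.snoc_castSucc]
    fun_prop

instance (m : ι → Model Pol O) {Φ : Finset (Finset (ι × Pol))} (E : Environment O Φ)
    (L : Learner Pol O) (t : ℕ) : IsProbabilityMeasure (historyLaw m E L t) := by
  induction t with
  | zero => rw [historyLaw]; infer_instance
  | succ t ih =>
    rw [historyLaw]
    exact Measure.isProbabilityMeasure_map (measurable_snoc t).aemeasurable

/-- Against an environment with independent pairs, the expected regret in a round is the expected
regret of the learner's policy against the mixture. -/
lemma le_integral_roundRegret_stepKernel (m : ι → Model Pol O) {Φ : Finset (Finset (ι × Pol))}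
    {φ : Finset (ι × Pol)} (hφ : φ ∈ Φ) {ν : ι × Pol → ℝ} (hν : ν ∈ distOn φ) (L : Learner Pol O)
    {c : ℝ} (hc : ∀ π, c ≤ gain m ν π) (t : ℕ) (h : Fin t → Round ι Pol O) :
    c ≤ ∫ x, roundRegret m x ∂(stepKernel m (iidEnvironment O hφ hν) L t h) := by
  have := isProbabilityMeasure_weightMeasure hν.1
  have := L.markov t
  have := (iidEnvironment O hφ hν).markov t
  set G : (ι × Pol) × Pol → ℝ := fun x => (m x.1.1).value x.1.2 - (m x.1.1).value x.2 with hG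
  have hint : Integrable (roundRegret m) (stepKernel m (iidEnvironment O hφ hν) L t h) :=
    integrable_roundRegret m _ measurable_id
  rw [stepKernel] at hint ⊢
  rw [ProbabilityTheory.integral_compProd hint]
  have hinner : ∀ x : (ι × Pol) × Pol, ∫ y, roundRegret m (x, y) ∂((obsKernel m).prodMkLeft
      (Fin t → Round ι Pol O) (h, x)) = G x := by
    intro x
    simp [roundRegret, hG]
  simp_rw [hinner]
  -- Pair and policy are independent given the history, so the pair can be averaged out first for
  -- each fixed policy.
  rw [Kernel.prod_apply, integral_prod_symm _ (Integrable.of_finite)]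
  have hG' : ∀ π, ∫ ψ, G (ψ, π) ∂((iidEnvironment O hφ hν).select t h) = gain m ν π := by
    intro π
    exact integral_weightMeasure hν.1.1 fun ψ => G (ψ, π)
  simp_rw [hG']
  calc c = ∫ _, c ∂((L.act t).comap (fun (h : Fin t → Round ι Pol O) s => ((h s).1.2, (h s).2))
        (by fun_prop) h) := by simp
    _ ≤ _ := integral_mono (integrable_const c) Integrable.of_finite hc

/-- The bound on one round holds for every history, so nothing that the learner has observed can
help and the rounds add up. -/
theorem mul_le_expectedRegret_iidEnvironment (m : ι → Model Pol O)
    {Φ : Finset (Finset (ι × Pol))}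
    {φ : Finset (ι × Pol)} (hφ : φ ∈ Φ) {ν : ι × Pol → ℝ} (hν : ν ∈ distOn φ) (L : Learner Pol O)
    {c : ℝ} (hc : ∀ π, c ≤ gain m ν π) (T : ℕ) :
    c * T ≤ expectedRegret m (iidEnvironment O hφ hν) L T := by
  induction T with
  | zero => simp [expectedRegret]
  | succ T ih =>
    set E := iidEnvironment O hφ hν
    have hstep : Integrable (fun h => ∫ x, roundRegret m x ∂(stepKernel m E L T h))
        (historyLaw m E L T) :=
      (integrable_roundRegret m (historyLaw m E L T ⊗ₘ stepKernel m E L T)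
        measurable_snd).integral_compProd
    have hmeas : Measurable fun h : Fin (T + 1) → Round ι Pol O => ∑ s, roundRegret m (h s) := by
      fun_prop
    have hsplit : expectedRegret m E L (T + 1) = expectedRegret m E L T +
        ∫ h, ∫ x, roundRegret m x ∂(stepKernel m E L T h) ∂(historyLaw m E L T) := by
      calc expectedRegret m E L (T + 1)
          = ∫ h, ∑ s, roundRegret m (h s) ∂(historyLaw m E L (T + 1)) := rfl
        _ = ∫ x, ((∑ s, roundRegret m (x.1 s)) + roundRegret m x.2)
              ∂(historyLaw m E L T ⊗ₘ stepKernel m E L T) := by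
            rw [historyLaw, integral_map (measurable_snoc T).aemeasurable
              hmeas.aestronglyMeasurable]
            simp [Fin.sum_univ_castSucc]
        _ = _ := by
            rw [integral_add, Measure.integral_compProd, Measure.integral_compProd]
            · simp only [integral_const, probReal_univ, one_smul]
              rfl
            · exact integrable_roundRegret m _ measurable_snd
            · exact integrable_finsetSum _ fun s _ =>
                integrable_roundRegret m _ ((measurable_pi_apply s).comp measurable_fst)
            · exact integrable_finsetSum _ fun s _ =>
                integrable_roundRegret m _ ((measurable_pi_apply s).comp measurable_fst)
            · exact integrable_roundRegret m _ measurable_snd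
    have hround : c ≤ ∫ h, ∫ x, roundRegret m x ∂(stepKernel m E L T h) ∂(historyLaw m E L T) := by
      calc c = ∫ _, c ∂(historyLaw m E L T) := by simp
        _ ≤ _ := integral_mono (integrable_const c) hstep fun h =>
            le_integral_roundRegret_stepKernel m hφ hν L hc T h
    rw [hsplit]
    push_cast
    linarith

end Regret

end DecisionMaking

theorem lemma2 {ι Pol O : Type*} [Fintype ι] [DecidableEq ι] [MeasurableSpace ι]
    [MeasurableSingletonClass ι] [Fintype Pol] [DecidableEq Pol] [Nonempty Pol]
    [MeasurableSpace Pol] [MeasurableSingletonClass Pol] [MeasurableSpace O]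
    (m : ι → DecisionMaking.Model Pol O) (Φ : Finset (Finset (ι × Pol)))
    (hΦ : (Φ : Set (Finset (ι × Pol))).PairwiseDisjoint id) :
    (∀ η : ℝ, 0 < η →
      DecisionMaking.AIRValue η m Φ = DecisionMaking.DECPhi η m Φ) ∧
    (DecisionMaking.comparatorGap m Φ ≤ 0 → ∀ η : ℝ, 0 < η →
      DecisionMaking.AIRValue η m Φ ≤
        DecisionMaking.DEC η (DecisionMaking.convexification m Φ)) ∧
    (0 < DecisionMaking.comparatorGap m Φ →
      ¬ DecisionMaking.FixedComparator Φ ∧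
      (∀ η : ℝ, 0 < η →
        ((DecisionMaking.comparatorGap m Φ : ℝ) : EReal) ≤ DecisionMaking.AIRValue η m Φ) ∧
      ∃ E : DecisionMaking.Environment O Φ, ∀ (L : DecisionMaking.Learner Pol O) (T : ℕ),
        DecisionMaking.comparatorGap m Φ * T ≤ DecisionMaking.expectedRegret m E L T) := by
  refine ⟨fun η hη => le_antisymm (DecisionMaking.AIRValue_le_DECPhi hη m hΦ)
    (DecisionMaking.DECPhi_le_AIRValue hη m hΦ),
    fun hgap η hη => DecisionMaking.AIRValue_le_DEC_convexification hη m hΦ hgap,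
    fun hgap => ⟨fun h => absurd hgap
      (not_lt.2 (DecisionMaking.comparatorGap_nonpos_of_fixedComparator m h)), ?_⟩⟩
  -- One maximizer serves both as the bad prior for AIR and as the law of the environment.
  obtain ⟨φ, hφ, ν, hν, heq⟩ := DecisionMaking.exists_eq_comparatorGap m hgap
  rw [heq]
  refine ⟨fun η hη => DecisionMaking.comparatorValue_sub_le_AIRValue hη m hΦ hφ hν,
    DecisionMaking.iidEnvironment O hφ hν, fun L T =>
      DecisionMaking.mul_le_expectedRegret_iidEnvironment m hφ hν L (fun π => ?_) T⟩
  rw [DecisionMaking.gain_eq m ν hν.1]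
  linarith [DecisionMaking.Model.value_le_opt (DecisionMaking.mix m ν hν.1) π]
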